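/- Let $(L,d)$ be a (countable) metric space of bounded geometry: the number of points of a ball is bounded in terms of its diameter. All algebras are unital $*$-algebras over $\mathbb C$, all homomorphisms are unital, and $\ast$ denotes the free product (coproduct) of unital $*$-algebras. For $U\subseteq L$ let $U^{+s}=\{x: d(x,U)\le s\}$ and let $\mathfrak F_D(U)$ be the set of $V\subseteq U$ with $\operatorname{diam} V\le D$; put $d(U,V)=\inf_{x\in U,y\in V}d(x,y)$, which is $\infty$ if $U$ or $V$ is empty. A quasi-local $*$-algebra $\mathcal A$ over $L$ is a $*$-algebra $\mathcal A_L$ with $*$-subalgebras $\mathcal A_U$ ($U\subseteq L$), increasing in $U$ and equal to $\mathcal A_L$ for $U=L$, such that: $\mathcal A_U$ is the union of the $\mathcal A_V$ with $V\subseteq U$ finite; for some $\delta\ge 0$ it is $\delta$-locally commutative, i.e. $\ker(\mathcal A_U\ast\mathcal A_V\to\mathcal A_L)$ is the ideal $[\mathcal A_U,\mathcal A_V]$ generated by the commutators whenever $d(U,V)>\delta$; and for some $R,\gamma\ge 0$ the centralizer of $\mathcal A_{F^c}$ is contained in $\mathcal A_{F^{+\gamma}}$ for all balls $F$ of diameter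 at least $R$. It is locally presented with parameters $(D,T)$ if there are $r,t\ge0$ with $D\le T$, $r\le t$ such that for every $U\subseteq L$ the image of $\ast_{V\in\mathfrak F_D(U^{+r})}\mathcal A_V\to\mathcal A_L$ contains $\mathcal A_U$, and the kernel of this map is contained in the ideal of $\ast_{V\in\mathfrak F_T(U^{+t})}\mathcal A_V$ generated by the kernels of $\mathcal A_V\ast\mathcal A_W\to\mathcal A_L$, $V,W\in\mathfrak F_T(U^{+t})$. It is locally presented if it is so for some $(D,T)$. Let $G_0\subseteq\operatorname{Iso}(L,d)$ be a subgroup. $\mathcal A$ is $G_0$-covariant if it is equipped with a homomorphism $\phi:G_0\to\operatorname{Aut}(\mathcal A_L)$ with $\phi_g(\mathcal A_U)=\mathcal A_{gU}$. A morphism $\alpha:\mathcal A\to\mathcal B$ of $G_0$-covariant quasi-local $*$-algebras is a $*$-homomorphism $\mathcal A_L\to\mathcal B_L$ that intertwines the $G_0$-actions and has bounded spread: for some $s\ge0$ (then $\alpha$ is said to have spread $s$), $\alpha(\mathcal A_U)\subseteq\mathcal B_{U^{+s}}$ for all finite $U$. For a subgroup $G\subseteq G_0$ and parameters $(\delta,D,T)$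 such that $\mathcal A$ is $\delta$-locally commutative and locally presented with parameters $(D,T)$, let $\mathrm{Cpt}^G_{D,T}(\mathcal A,\delta)$ be the quotient of $\ast_{V\in\mathfrak F_D(L)}\mathcal A_V$ by the contraction of the sum of the following ideals of $\ast_{V\in\mathfrak F_T(L)}\mathcal A_V$, where $V,W$ range over $\mathfrak F_T(L)$: the ideal generated by the kernels of $\mathcal A_V\ast\mathcal A_W\to\mathcal A_L$ with $d(V,W)\le\delta$; the ideal generated by the commutators $[\mathcal A_V,\mathcal A_W]$ with $d(GV,GW)>\delta$, where $GV=\bigcup_{g\in G}gV$; and the ideal generated by the differences of $a\in\mathcal A_V$ and $\phi_g(a)\in\mathcal A_{gV}$, $g\in G$. Let $\{G_\lambda\}_{\lambda\in\Lambda}$ be an asymptotically free family of subgroups of $G_0$: $\Lambda$ is infinite, and for each $T\ge 0$, for all but finitely many $\lambda$, the only $g\in G_\lambda$ for which $gU\cap U\ne\emptyset$ for some $U\subseteq L$ with $\operatorname{diam}U\le T$ is $g=1$. Put $$\mathrm{Cpt}^\Lambda_{D,T}(\mathcal A,\delta)=\prod_{\lambda}\mathrm{Cpt}^{G_\lambda}_{D,T}(\mathcal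 A,\delta)\Big/\bigoplus_\lambda \mathrm{Cpt}^{G_\lambda}_{D,T}(\mathcal A,\delta).$$ Inclusion of letters ($a\in\mathcal A_V\mapsto a\in\mathcal A_V$) induces canonical $*$-homomorphisms between these algebras for componentwise increasing $(\delta,D,T)$. If $\alpha:\mathcal A\to\mathcal B$ has spread $s$ and $\delta\le\delta'$, $D+2s\le D'$, $T+2s\le T'$, then $a\in\mathcal A_V\mapsto\alpha(a)\in\mathcal B_{V^{+s}}$ induces a canonical $*$-homomorphism $\alpha_*:\mathrm{Cpt}^\Lambda_{D,T}(\mathcal A,\delta)\to\mathrm{Cpt}^\Lambda_{D',T'}(\mathcal B,\delta')$. Then: 1. If $\mathcal A$ is locally presented, there are admissible parameters $(\delta,D,T)$ of $\mathcal A$ that are all larger than any given number. 2. The canonical map $\mathrm{Cpt}^\Lambda_{D,T}(\mathcal A,\delta)\to\mathrm{Cpt}^\Lambda_{D',T}(\mathcal A,\delta')$ for $D\le D'$, $\delta\le\delta'$ (and the same $T$) is an isomorphism, so that these algebras define, up to canonical isomorphism, an algebra $\mathrm{Cpt}^\Lambda_T(\mathcal A)$ depending only on $T$. 3. The asymptotic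 compactified algebra $\mathrm{Cpt}^\Lambda(\mathcal A)=\operatorname{colim}_T\mathrm{Cpt}^\Lambda_T(\mathcal A)$ (the colimit of the algebras $\mathrm{Cpt}^\Lambda_{D,T}(\mathcal A,\delta)$ over all admissible $(\delta,D,T)$) is a functor from the full subcategory of locally presented objects of the category of $G_0$-covariant quasi-local $*$-algebras over $L$ and $G_0$-equivariant bounded-spread $*$-homomorphisms to the category of $*$-algebras; its value $\mathrm{Cpt}^\Lambda(\alpha)$ on a morphism $\alpha$ is compatible with all the maps $\alpha_*$ and the colimit maps. -/

import Mathlib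

universe u v w

open scoped ENNReal NNReal
open CategoryTheory

noncomputable section

set_option linter.unusedSectionVars false

/-! ### Free products of unital `*`-algebras -/

section FreeProduct

variable {ι : Type u} (X : ι → Type w) [∀ i, Ring (X i)] [∀ i, StarRing (X i)]
  [∀ i, Algebra ℂ (X i)] [∀ i, StarModule ℂ (X i)]

open Classical in
/-- The free product (coproduct) `⁎ᵢ X i` of a family of unital `*`-algebras over `ℂ`. The underlying
algebra is the coproduct of unital `ℂ`-algebras; the involution extends those of the factors. -/
def StarFreeProduct : Type (max u w) := LinearAlgebra.FreeProduct ℂ X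

namespace StarFreeProduct

open Classical in
instance instRing : Ring (StarFreeProduct X) :=
  inferInstanceAs (Ring (LinearAlgebra.FreeProduct ℂ X))

open Classical in
instance instAlgebra : Algebra ℂ (StarFreeProduct X) :=
  inferInstanceAs (Algebra ℂ (LinearAlgebra.FreeProduct ℂ X))

open Classical in
/-- The canonical map of a factor into the free product, as an algebra map. -/
def ofAlg (i : ι) : X i →ₐ[ℂ] StarFreeProduct X := LinearAlgebra.FreeProduct.ι ℂ X i

variable {X}

open Classical in
/-- The universal property for unital algebras. -/
def liftAlg {C : Type v} [Ring C] [Algebra ℂ C] (f : ∀ i, X i →ₐ[ℂ] C) :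
    StarFreeProduct X →ₐ[ℂ] C :=
  LinearAlgebra.FreeProduct.lift ℂ X (fun {i} => f i)

open Classical in
theorem liftAlg_ofAlg {C : Type v} [Ring C] [Algebra ℂ C] (f : ∀ i, X i →ₐ[ℂ] C) (i : ι)
    (a : X i) : liftAlg f (ofAlg X i a) = f i a :=
  DFunLike.congr_fun (LinearAlgebra.FreeProduct.lift_comp_ι ℂ X (fun {i} => f i) (i := i)) a

open Classical in
theorem algHom_ext {C : Type v} [Ring C] [Algebra ℂ C] {f g : StarFreeProduct X →ₐ[ℂ] C}
    (h : ∀ i a, f (ofAlg X i a) = g (ofAlg X i a)) : f = g := by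
  have hg := LinearAlgebra.FreeProduct.lift_unique ℂ X
    (fun {i} => AlgHom.comp g (LinearAlgebra.FreeProduct.ι ℂ X i)) g (fun i => rfl)
  have hf := LinearAlgebra.FreeProduct.lift_unique ℂ X
    (fun {i} => AlgHom.comp g (LinearAlgebra.FreeProduct.ι ℂ X i)) f
    (fun i => AlgHom.ext (h i))
  exact hf.trans hg.symm

theorem induction {p : StarFreeProduct X → Prop} (hι : ∀ i a, p (ofAlg X i a))
    (hc : ∀ r : ℂ, p (algebraMap ℂ _ r)) (hadd : ∀ x y, p x → p y → p (x + y))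
    (hmul : ∀ x y, p x → p y → p (x * y)) (x : StarFreeProduct X) : p x := by
  let S : Subalgebra ℂ (StarFreeProduct X) :=
    { carrier := {x | p x}
      mul_mem' := fun ha hb => hmul _ _ ha hb
      add_mem' := fun ha hb => hadd _ _ ha hb
      algebraMap_mem' := hc }
  let f : StarFreeProduct X →ₐ[ℂ] S := liftAlg fun i => (ofAlg X i).codRestrict S (hι i)
  have hf : S.val.comp f = AlgHom.id ℂ _ := algHom_ext fun i a => by
    simp [f, liftAlg_ofAlg]
  have := DFunLike.congr_fun hf x
  simp only [AlgHom.comp_apply, AlgHom.id_apply] at this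
  rw [← this]
  exact (f x).2

/-- The opposite of a complex algebra, with the conjugate scalar action. -/
def ConjOp (C : Type v) : Type v := Cᵐᵒᵖ

instance (C : Type v) [Ring C] : Ring (ConjOp C) := inferInstanceAs (Ring Cᵐᵒᵖ)

instance (C : Type v) [Ring C] [Algebra ℂ C] : Algebra ℂ (ConjOp C) :=
  Algebra.compHom Cᵐᵒᵖ (starRingEnd ℂ)

variable (X) in
/-- The involution of the free product, as a map into the conjugate opposite algebra. -/
def starHom : StarFreeProduct X →ₐ[ℂ] ConjOp (StarFreeProduct X) :=
  liftAlg fun i =>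
    { toFun := fun a => (MulOpposite.op (ofAlg X i (star a)) : (StarFreeProduct X)ᵐᵒᵖ)
      map_one' := by rw [star_one, map_one]; rfl
      map_mul' := fun a b => by rw [star_mul, map_mul]; rfl
      map_zero' := by rw [star_zero, map_zero]; rfl
      map_add' := fun a b => by rw [star_add, map_add]; rfl
      commutes' := fun r => by
        rw [← algebraMap_star_comm, AlgHom.commutes]; rfl }

instance instStar : Star (StarFreeProduct X) where
  star x := MulOpposite.unop (starHom X x : (StarFreeProduct X)ᵐᵒᵖ)

theorem star_def (x : StarFreeProduct X) :
    star x = MulOpposite.unop (starHom X x : (StarFreeProduct X)ᵐᵒᵖ) := rfl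

theorem star_ofAlg (i : ι) (a : X i) : star (ofAlg X i a) = ofAlg X i (star a) := by
  rw [star_def, starHom, liftAlg_ofAlg]; rfl

theorem star_algebraMap (r : ℂ) :
    star (algebraMap ℂ (StarFreeProduct X) r) = algebraMap ℂ _ (star r) := by
  rw [star_def, AlgHom.commutes]; rfl

theorem star_add_aux (x y : StarFreeProduct X) : star (x + y) = star x + star y := by
  simp only [star_def, map_add]; rfl

theorem star_mul_aux (x y : StarFreeProduct X) : star (x * y) = star y * star x := by
  simp only [star_def, map_mul]; rfl

instance instStarRing : StarRing (StarFreeProduct X) where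
  star_involutive x := by
    induction x using StarFreeProduct.induction with
    | hι i a => rw [star_ofAlg, star_ofAlg, star_star]
    | hc r => rw [star_algebraMap, star_algebraMap, star_star]
    | hadd x y hx hy => rw [star_add_aux, star_add_aux, hx, hy]
    | hmul x y hx hy => rw [star_mul_aux, star_mul_aux, hx, hy]
  star_mul := star_mul_aux
  star_add := star_add_aux

instance instStarModule : StarModule ℂ (StarFreeProduct X) where
  star_smul r x := by
    rw [Algebra.smul_def, star_mul, star_algebraMap, ← Algebra.commutes, ← Algebra.smul_def]

variable (X) in
/-- The canonical `*`-homomorphism `X i → ⁎ᵢ X i`. -/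
def of (i : ι) : X i →⋆ₐ[ℂ] StarFreeProduct X :=
  { ofAlg X i with map_star' := fun a => (star_ofAlg i a).symm }

/-- The universal property: a family of `*`-homomorphisms `X i → C` induces `⁎ᵢ X i → C`. -/
def lift {C : Type v} [Ring C] [StarRing C] [Algebra ℂ C] [StarModule ℂ C]
    (f : ∀ i, X i →⋆ₐ[ℂ] C) : StarFreeProduct X →⋆ₐ[ℂ] C :=
  { liftAlg fun i => (f i).toAlgHom with
    map_star' := fun x => by
      change liftAlg (fun i => (f i).toAlgHom) (star x)
        = star (liftAlg (fun i => (f i).toAlgHom) x)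
      induction x using StarFreeProduct.induction with
      | hι i a => rw [star_ofAlg, liftAlg_ofAlg, liftAlg_ofAlg]; exact map_star (f i) a
      | hc r => rw [star_algebraMap, AlgHom.commutes, AlgHom.commutes, algebraMap_star_comm]
      | hadd x y hx hy => rw [star_add, map_add, map_add, star_add, hx, hy]
      | hmul x y hx hy => rw [star_mul, map_mul, map_mul, star_mul, hx, hy] }

theorem lift_of {C : Type v} [Ring C] [StarRing C] [Algebra ℂ C] [StarModule ℂ C]
    (f : ∀ i, X i →⋆ₐ[ℂ] C) (i : ι) (a : X i) : lift f (of X i a) = f i a :=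
  liftAlg_ofAlg (fun i => (f i).toAlgHom) i a

theorem hom_ext {C : Type v} [Ring C] [StarRing C] [Algebra ℂ C] [StarModule ℂ C]
    {f g : StarFreeProduct X →⋆ₐ[ℂ] C} (h : ∀ i a, f (of X i a) = g (of X i a)) : f = g := by
  have : f.toAlgHom = g.toAlgHom := algHom_ext h
  ext x
  exact DFunLike.congr_fun this x

end StarFreeProduct

end FreeProduct

/-! ### Quotients by `*`-closed two-sided ideals -/

/-- A two-sided ideal that is closed under the involution. -/
class TwoSidedIdeal.IsStarClosed {A : Type u} [Ring A] [StarRing A] (I : TwoSidedIdeal A) :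
    Prop where
  star_mem : ∀ x ∈ I, star x ∈ I

/-- The quotient of a `*`-algebra by a `*`-closed two-sided ideal. -/
def StarQuotient {A : Type u} [Ring A] (I : TwoSidedIdeal A) : Type u := I.ringCon.Quotient

namespace StarQuotient

variable {A : Type u} [Ring A] [StarRing A] [Algebra ℂ A] [StarModule ℂ A]
  (I : TwoSidedIdeal A)

instance : Ring (StarQuotient I) := inferInstanceAs (Ring I.ringCon.Quotient)

instance : Algebra ℂ (StarQuotient I) := inferInstanceAs (Algebra ℂ I.ringCon.Quotient)

/-- The quotient map, as an algebra map. -/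
def mkAlg : A →ₐ[ℂ] StarQuotient I := RingCon.mkₐ ℂ I.ringCon

theorem mkAlg_surjective : Function.Surjective (mkAlg I) := RingCon.mkₐ_surjective _

theorem mkAlg_eq_iff {x y : A} : mkAlg I x = mkAlg I y ↔ x - y ∈ I :=
  (RingCon.eq I.ringCon).trans (I.rel_iff x y)

variable [I.IsStarClosed]

instance : StarRing (StarQuotient I) where
  star := Quotient.lift (fun x => mkAlg I (star x)) fun x y h => by
    have h1 : x - y ∈ I := (I.rel_iff x y).1 h
    refine (mkAlg_eq_iff I).2 ?_
    rw [← star_sub]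
    exact TwoSidedIdeal.IsStarClosed.star_mem _ h1
  star_involutive x := by
    obtain ⟨x, rfl⟩ := mkAlg_surjective I x
    change mkAlg I (star (star x)) = _
    rw [star_star]
  star_mul x y := by
    obtain ⟨x, rfl⟩ := mkAlg_surjective I x
    obtain ⟨y, rfl⟩ := mkAlg_surjective I y
    change mkAlg I (star (x * y)) = mkAlg I (star y) * mkAlg I (star x)
    rw [star_mul, map_mul]
  star_add x y := by
    obtain ⟨x, rfl⟩ := mkAlg_surjective I x
    obtain ⟨y, rfl⟩ := mkAlg_surjective I y
    change mkAlg I (star (x + y)) = mkAlg I (star x) + mkAlg I (star y)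
    rw [star_add, map_add]

/-- The quotient map. -/
def mk : A →⋆ₐ[ℂ] StarQuotient I := { mkAlg I with map_star' := fun _ => rfl }

theorem mk_surjective : Function.Surjective (mk I) := mkAlg_surjective I

theorem mk_eq_iff {x y : A} : mk I x = mk I y ↔ x - y ∈ I := mkAlg_eq_iff I

theorem mk_eq_zero_iff {x : A} : mk I x = 0 ↔ x ∈ I := by
  rw [← map_zero (mk I), mk_eq_iff, sub_zero]

instance : StarModule ℂ (StarQuotient I) where
  star_smul r x := by
    obtain ⟨x, rfl⟩ := mk_surjective I x
    rw [← map_smul, ← map_star, ← map_star, star_smul, map_smul]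

variable {C : Type v} [Ring C] [StarRing C] [Algebra ℂ C] [StarModule ℂ C]

/-- A `*`-homomorphism that vanishes on `I` factors through the quotient by `I`. -/
def lift (f : A →⋆ₐ[ℂ] C) (h : ∀ x ∈ I, f x = 0) : StarQuotient I →⋆ₐ[ℂ] C :=
  { RingCon.liftₐ I.ringCon f.toAlgHom (fun x y hxy => by
      have h1 := h _ ((I.rel_iff x y).1 hxy)
      rw [map_sub, sub_eq_zero] at h1
      exact h1) with
    map_star' := fun x => by
      obtain ⟨x, rfl⟩ := mk_surjective I x
      exact map_star f x }

theorem lift_mk (f : A →⋆ₐ[ℂ] C) (h : ∀ x ∈ I, f x = 0) (x : A) :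
    lift I f h (mk I x) = f x := rfl

variable {I} in
theorem hom_ext {f g : StarQuotient I →⋆ₐ[ℂ] C} (h : ∀ x, f (mk I x) = g (mk I x)) :
    f = g := by
  ext x
  obtain ⟨x, rfl⟩ := mk_surjective I x
  exact h x

end StarQuotient

namespace TwoSidedIdeal

variable {A : Type u} [Ring A] [StarRing A]

theorem isStarClosed_span {s : Set A} (h : ∀ x ∈ s, star x ∈ s) : (span s).IsStarClosed where
  star_mem x hx := by
    let J : TwoSidedIdeal A := TwoSidedIdeal.mk' {x | star x ∈ span s}
      (show star (0 : A) ∈ span s by rw [star_zero]; exact zero_mem _)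
      (fun {x y} (hx : star x ∈ span s) (hy : star y ∈ span s) =>
        show star (x + y) ∈ span s by rw [star_add]; exact add_mem _ hx hy)
      (fun {x} (hx : star x ∈ span s) =>
        show star (-x) ∈ span s by rw [star_neg]; exact neg_mem _ hx)
      (fun {x y} (hy : star y ∈ span s) =>
        show star (x * y) ∈ span s by rw [star_mul]; exact mul_mem_right _ _ _ hy)
      (fun {x y} (hx : star x ∈ span s) =>
        show star (x * y) ∈ span s by rw [star_mul]; exact mul_mem_left _ _ _ hx)
    have hJ : span s ≤ J := span_le.2 fun x hx =>
      (mem_mk' _ _ _ _ _ _ x).2 (subset_span (h x hx))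
    exact (mem_mk' _ _ _ _ _ _ x).1 (hJ hx)

instance isStarClosed_sup (I J : TwoSidedIdeal A) [I.IsStarClosed] [J.IsStarClosed] :
    (I ⊔ J).IsStarClosed where
  star_mem x hx := by
    obtain ⟨y, hy, z, hz, rfl⟩ := mem_sup.1 hx
    rw [star_add]
    exact mem_sup.2 ⟨_, IsStarClosed.star_mem _ hy, _, IsStarClosed.star_mem _ hz, rfl⟩

instance isStarClosed_comap {B : Type v} [Ring B] [StarRing B] [Algebra ℂ A] [Algebra ℂ B]
    (f : A →⋆ₐ[ℂ] B) (I : TwoSidedIdeal B) [I.IsStarClosed] :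
    (I.comap f).IsStarClosed where
  star_mem x hx := by
    rw [mem_comap] at hx ⊢
    rw [map_star]
    exact IsStarClosed.star_mem _ hx

end TwoSidedIdeal

/-! ### The underlying metric space -/

section Geometry

variable {L : Type u} [MetricSpace L]

/-- Bounded geometry: the cardinality of open balls is bounded in terms of their diameter. (Such a
space is automatically countable and discrete.) -/
class BoundedGeometry (L : Type u) [MetricSpace L] : Prop where
  exists_encard_le : ∀ D : ℝ≥0, ∃ N : ℕ, ∀ (x : L) (r : ℝ), 0 < r →
    Metric.ediam (Metric.ball x r) ≤ D → (Metric.ball x r).encard ≤ N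

/-- The distance `d(U, V) = inf {d(x, y) | x ∈ U, y ∈ V}` between two subsets, with
`d(U, V) = ∞` if one of them is empty. -/
def setEDist (U V : Set L) : ℝ≥0∞ := ⨅ x ∈ U, Metric.infEDist x V

/-- The `s`-neighbourhood `U⁺ˢ = {x | d(x, U) ≤ s}`. -/
def nbhd (s : ℝ≥0) (U : Set L) : Set L := Metric.cthickening (s : ℝ) U

theorem nbhd_mono {r t : ℝ≥0} (h : r ≤ t) (U : Set L) : nbhd r U ⊆ nbhd t U :=
  Metric.cthickening_mono (NNReal.coe_le_coe.2 h) U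

/-- The family `𝔉_D(U)` of the subsets of `U` of diameter at most `D`. They are finite if `L` has
bounded geometry. -/
@[ext]
structure Region (D : ℝ≥0) (U : Set L) where
  carrier : Set L
  subset : carrier ⊆ U
  ediam_le : Metric.ediam carrier ≤ D

/-- The union `GU` of the translates of `U` under a group of isometries. -/
def orbitUnion {G₀ : Subgroup (L ≃ᵢ L)} (G : Subgroup G₀) (U : Set L) : Set L :=
  ⋃ g ∈ G, (g : L ≃ᵢ L) '' U

/-- `G` acts freely at scale `T`: if `diam U ≤ T` and `gU` meets `U`, then `g = 1`. -/
def FreeAtScale {G₀ : Subgroup (L ≃ᵢ L)} (G : Subgroup G₀) (T : ℝ≥0) : Prop :=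
  ∀ U : Set L, Metric.ediam U ≤ T → ∀ g ∈ G, (((g : L ≃ᵢ L) '' U) ∩ U).Nonempty → g = 1

/-- An infinite family of subgroups of `G₀` is asymptotically free if for every `T ≥ 0` only
finitely many of its members do not act freely at scale `T`. -/
def AsymptoticallyFree {G₀ : Subgroup (L ≃ᵢ L)} {Λ : Type v} (G : Λ → Subgroup G₀) : Prop :=
  Infinite Λ ∧ ∀ T : ℝ≥0, {l : Λ | ¬ FreeAtScale (G l) T}.Finite

theorem setEDist_le {U V : Set L} {x y : L} (hx : x ∈ U) (hy : y ∈ V) :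
    setEDist U V ≤ edist x y :=
  (iInf₂_le x hx).trans (Metric.infEDist_le_edist_of_mem hy)

theorem le_setEDist {U V : Set L} {c : ℝ≥0∞} (h : ∀ x ∈ U, ∀ y ∈ V, c ≤ edist x y) :
    c ≤ setEDist U V :=
  le_iInf₂ fun x hx => Metric.le_infEDist.2 fun y hy => h x hx y hy

theorem setEDist_anti {U V U₁ V₁ : Set L} (hU : U ⊆ U₁) (hV : V ⊆ V₁) :
    setEDist U₁ V₁ ≤ setEDist U V :=
  le_setEDist fun _ hx _ hy => setEDist_le (hU hx) (hV hy)

theorem BoundedGeometry.finite_closedBall [BoundedGeometry L] (x : L) (r : ℝ) :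
    (Metric.closedBall x r).Finite := by
  have hr : (0 : ℝ) < |r| + 1 := by positivity
  obtain ⟨N, hN⟩ := BoundedGeometry.exists_encard_le (L := L) (2 * (Real.toNNReal (|r| + 1)))
  have h1 : Metric.ediam (Metric.ball x (|r| + 1)) ≤ (2 * (Real.toNNReal (|r| + 1)) : ℝ≥0) := by
    rw [← Metric.eball_ofReal]
    refine Metric.ediam_eball_le.trans ?_
    simp [ENNReal.ofReal]
  have h2 := hN x _ hr h1
  refine (Set.finite_of_encard_le_coe h2).subset fun y hy => ?_
  rw [Metric.mem_closedBall] at hy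
  rw [Metric.mem_ball]
  have := le_abs_self r
  linarith

/-- For a set of finite diameter the distance to another set is attained. -/
theorem exists_edist_le_of_setEDist_le [BoundedGeometry L] {U V : Set L} {D δ : ℝ≥0}
    (hU : Metric.ediam U ≤ D) (h : setEDist U V ≤ δ) : ∃ x ∈ U, ∃ y ∈ V, edist x y ≤ δ := by
  by_contra! hc
  have hne : U.Nonempty := by
    rw [Set.nonempty_iff_ne_empty]
    rintro rfl
    simp [setEDist] at h
  obtain ⟨x₀, hx₀⟩ := hne
  let K : Set L := Metric.closedBall x₀ ((D : ℝ) + δ + 1)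
  have hK : K.Finite := BoundedGeometry.finite_closedBall x₀ _
  let F : Set (L × L) := {z | z.1 ∈ U ∧ z.2 ∈ V ∧ edist z.1 z.2 ≤ (δ : ℝ≥0∞) + 1}
  have hd : ∀ {x y : L} {c : ℝ≥0}, edist x y ≤ c → dist x y ≤ c := fun {x y c} hxy => by
    rw [edist_nndist, ENNReal.coe_le_coe] at hxy
    rw [dist_nndist]
    exact_mod_cast hxy
  have hF : F.Finite := by
    refine (hK.prod hK).subset ?_
    rintro ⟨x, y⟩ ⟨hx, hy, hxy⟩
    have h1 : dist x x₀ ≤ D := hd ((Metric.edist_le_ediam_of_mem hx hx₀).trans hU)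
    have h2 : dist x y ≤ ((δ + 1 : ℝ≥0) : ℝ) := hd (by simpa using hxy)
    have h3 := dist_triangle y x x₀
    rw [dist_comm y x] at h3
    push_cast at h2
    have hδ : (0 : ℝ) ≤ δ := δ.2
    constructor
    · change dist x x₀ ≤ _
      linarith
    · change dist y x₀ ≤ _
      linarith
  have hlt : (δ : ℝ≥0∞) < δ + 1 := ENNReal.lt_add_right (by simp) (by simp)
  have key : ∃ c : ℝ≥0∞, (δ : ℝ≥0∞) < c ∧ ∀ x ∈ U, ∀ y ∈ V, c ≤ edist x y := by
    rcases F.eq_empty_or_nonempty with hE | hN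
    · refine ⟨δ + 1, hlt, fun x hx y hy => ?_⟩
      by_contra! hxy
      have : (x, y) ∈ F := ⟨hx, hy, hxy.le⟩
      simp [hE] at this
    · obtain ⟨z, hz, hmin⟩ := Set.exists_min_image F (fun z => edist z.1 z.2) hF hN
      refine ⟨edist z.1 z.2, hc _ hz.1 _ hz.2.1, fun x hx y hy => ?_⟩
      by_cases hxy : edist x y ≤ (δ : ℝ≥0∞) + 1
      · exact hmin (x, y) ⟨hx, hy, hxy⟩
      · exact hz.2.2.trans (le_of_not_ge hxy)
  obtain ⟨c, hc1, hc2⟩ := key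
  exact absurd ((le_setEDist hc2).trans h) (not_le.2 hc1)

theorem exists_setEDist_image_le [BoundedGeometry L] {G₀ : Subgroup (L ≃ᵢ L)} (G : Subgroup G₀)
    {U V : Set L} {D δ : ℝ≥0} (hU : Metric.ediam U ≤ D)
    (h : setEDist (orbitUnion G U) (orbitUnion G V) ≤ δ) :
    ∃ g ∈ G, setEDist U ((g : L ≃ᵢ L) '' V) ≤ δ := by
  have h1 : setEDist U (orbitUnion G V) ≤ setEDist (orbitUnion G U) (orbitUnion G V) := by
    refine le_setEDist fun x hx y hy => ?_
    simp only [orbitUnion, Set.mem_iUnion] at hx hy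
    obtain ⟨g, hg, x, hx, rfl⟩ := hx
    obtain ⟨k, hk, y, hy, rfl⟩ := hy
    have h2 : edist ((g : L ≃ᵢ L) x) ((k : L ≃ᵢ L) y)
        = edist x (((g⁻¹ * k : G₀) : L ≃ᵢ L) y) := by
      rw [← (g : L ≃ᵢ L).isometry.edist_eq x]
      congr 1
      change _ = ((g : L ≃ᵢ L) * (g : L ≃ᵢ L)⁻¹ * (k : L ≃ᵢ L)) y
      rw [mul_inv_cancel, one_mul]
    rw [h2]
    refine setEDist_le hx ?_
    simp only [orbitUnion, Set.mem_iUnion]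
    exact ⟨g⁻¹ * k, G.mul_mem (G.inv_mem hg) hk, y, hy, rfl⟩
  obtain ⟨x, hx, y, hy, hxy⟩ := exists_edist_le_of_setEDist_le hU (h1.trans h)
  simp only [orbitUnion, Set.mem_iUnion] at hy
  obtain ⟨g, hg, hy⟩ := hy
  exact ⟨g, hg, (setEDist_le hx hy).trans hxy⟩

/-- The distance of two orbits is at most the distance of two members of them. -/
theorem setEDist_orbitUnion_le {G₀ : Subgroup (L ≃ᵢ L)} {G : Subgroup G₀} {g : G₀} (hg : g ∈ G)
    (U V : Set L) :
    setEDist (orbitUnion G U) (orbitUnion G V) ≤ setEDist U ((g : L ≃ᵢ L) '' V) := by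
  refine setEDist_anti (fun x hx => ?_) (fun y hy => ?_)
  · simp only [orbitUnion, Set.mem_iUnion]
    exact ⟨1, G.one_mem, x, hx, rfl⟩
  · simp only [orbitUnion, Set.mem_iUnion]
    exact ⟨g, hg, hy⟩

/-- An equivariant way to replace each region by a larger one, by at most `s` in each direction. -/
structure Enlargement (L : Type u) [MetricSpace L] (s : ℝ≥0) where
  toFun : Set L → Set L
  subset : ∀ U, U ⊆ toFun U
  ediam_le : ∀ U, Metric.ediam (toFun U) ≤ Metric.ediam U + 2 * s
  image : ∀ (g : L ≃ᵢ L) (U : Set L), toFun (g '' U) = g '' toFun U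

/-- The trivial enlargement `U ↦ U`. -/
abbrev Enlargement.refl (L : Type u) [MetricSpace L] : Enlargement L 0 where
  toFun U := U
  subset _ := subset_rfl
  ediam_le _ := by simp
  image _ _ := rfl

/-- The enlargement `U ↦ U⁺ˢ`. -/
abbrev Enlargement.nbhd (L : Type u) [MetricSpace L] (s : ℝ≥0) : Enlargement L s where
  toFun := _root_.nbhd s
  subset := Metric.self_subset_cthickening
  ediam_le _ := Metric.ediam_cthickening_le s
  image g U := by
    ext x
    obtain ⟨x, rfl⟩ := g.surjective x
    simp only [_root_.nbhd, Metric.mem_cthickening_iff, g.injective.mem_set_image,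
      Metric.infEDist_image g.isometry]

/-- A set of diameter at most `D`, enlarged by `s`, has diameter at most `D + 2 s`. -/
abbrev Enlargement.mapRegion {s : ℝ≥0} (e : Enlargement L s) {D D₁ : ℝ≥0} (h : D + 2 * s ≤ D₁)
    (V : Region D (Set.univ : Set L)) : Region D₁ (Set.univ : Set L) :=
  ⟨e.toFun V.1, Set.subset_univ _, (e.ediam_le V.1).trans <| by
    have h1 : ((D + 2 * s : ℝ≥0) : ℝ≥0∞) ≤ D₁ := ENNReal.coe_le_coe.2 h
    push_cast at h1
    exact (add_le_add_left V.3 _).trans h1⟩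

/-- The inclusion `𝔉_D(U) ⊆ 𝔉_{D₁}(U₁)` for `D ≤ D₁` and `U ⊆ U₁`. -/
abbrev Region.incl {D D₁ : ℝ≥0} {U U₁ : Set L} (hD : D ≤ D₁) (hU : U ⊆ U₁) (V : Region D U) :
    Region D₁ U₁ :=
  ⟨V.1, V.2.trans hU, V.3.trans (ENNReal.coe_le_coe.2 hD)⟩

/-- The translate of a region by an isometry. -/
abbrev Region.translate {D : ℝ≥0} (g : L ≃ᵢ L) (V : Region D (Set.univ : Set L)) :
    Region D (Set.univ : Set L) :=
  ⟨g '' V.1, Set.subset_univ _, (g.isometry.ediam_image V.1).trans_le V.3⟩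

end Geometry

/-! ### Nets of local algebras and their free products -/

section Net

universe v₁ v₂ v₃ w₁ w₂ w₃

variable {L : Type u} {A : Type w₁} {B : Type w₂} {C : Type w₃}
  [Ring A] [StarRing A] [Algebra ℂ A] [StarModule ℂ A]
  [Ring B] [StarRing B] [Algebra ℂ B] [StarModule ℂ B]
  [Ring C] [StarRing C] [Algebra ℂ C] [StarModule ℂ C]
  {ι : Type v₁} {κ : Type v₂} {ν : Type v₃}

/-- The free product `⁎ᵢ A_{R i}` of the local algebras of a family of regions `R`. -/
abbrev NetProduct (N : Set L → StarSubalgebra ℂ A) (R : ι → Set L) : Type (max v₁ w₁) :=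
  StarFreeProduct fun i => N (R i)

namespace NetProduct

/-- The element `a ∈ A_{R i}` of the `i`-th factor. -/
def letter (N : Set L → StarSubalgebra ℂ A) (R : ι → Set L) (i : ι) (a : A)
    (ha : a ∈ N (R i)) : NetProduct N R :=
  StarFreeProduct.of (fun i => N (R i)) i ⟨a, ha⟩

/-- The canonical map `⁎ᵢ A_{R i} → A` induced by the inclusions. -/
def eval (N : Set L → StarSubalgebra ℂ A) (R : ι → Set L) : NetProduct N R →⋆ₐ[ℂ] A :=
  StarFreeProduct.lift fun i => (N (R i)).subtype

/-- A `*`-homomorphism `α` that maps the `i`-th factor into the `f i`-th factor induces a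
`*`-homomorphism of the free products. -/
def map {N : Set L → StarSubalgebra ℂ A} {M : Set L → StarSubalgebra ℂ B}
    {R : ι → Set L} {S : κ → Set L} (α : A →⋆ₐ[ℂ] B) (f : ι → κ)
    (h : ∀ i, ∀ a ∈ N (R i), α a ∈ M (S (f i))) : NetProduct N R →⋆ₐ[ℂ] NetProduct M S :=
  StarFreeProduct.lift fun i =>
    (StarFreeProduct.of (fun k => M (S k)) (f i)).comp
      (StarAlgHom.codRestrict (α.comp (N (R i)).subtype) (M (S (f i))) fun a => h i a.1 a.2)

variable {N : Set L → StarSubalgebra ℂ A} {M : Set L → StarSubalgebra ℂ B}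
  {P : Set L → StarSubalgebra ℂ C} {R : ι → Set L} {S : κ → Set L} {Q : ν → Set L}

theorem eval_letter (i : ι) (a : A) (ha : a ∈ N (R i)) : eval N R (letter N R i a ha) = a :=
  StarFreeProduct.lift_of _ _ _

theorem map_letter (α : A →⋆ₐ[ℂ] B) (f : ι → κ) (h : ∀ i, ∀ a ∈ N (R i), α a ∈ M (S (f i)))
    (i : ι) (a : A) (ha : a ∈ N (R i)) :
    map α f h (letter N R i a ha) = letter M S (f i) (α a) (h i a ha) :=
  StarFreeProduct.lift_of _ _ _

theorem hom_ext {f g : NetProduct N R →⋆ₐ[ℂ] C}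
    (h : ∀ i a ha, f (letter N R i a ha) = g (letter N R i a ha)) : f = g :=
  StarFreeProduct.hom_ext fun i a => h i a.1 a.2

theorem letter_congr {i j : ι} {a b : A} (hij : i = j) (hab : a = b) (ha : a ∈ N (R i))
    (hb : b ∈ N (R j)) : letter N R i a ha = letter N R j b hb := by
  subst hij hab
  rfl

theorem eval_map (α : A →⋆ₐ[ℂ] B) (f : ι → κ) (h : ∀ i, ∀ a ∈ N (R i), α a ∈ M (S (f i)))
    (x : NetProduct N R) : eval M S (map α f h x) = α (eval N R x) := by
  have : (eval M S).comp (map α f h) = α.comp (eval N R) := hom_ext fun i a ha => by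
    simp only [StarAlgHom.comp_apply, map_letter, eval_letter]
  exact DFunLike.congr_fun this x

theorem map_map (α : A →⋆ₐ[ℂ] B) (f : ι → κ) (h : ∀ i, ∀ a ∈ N (R i), α a ∈ M (S (f i)))
    (β : B →⋆ₐ[ℂ] C) (k : κ → ν) (hk : ∀ i, ∀ a ∈ M (S i), β a ∈ P (Q (k i)))
    (γ : A →⋆ₐ[ℂ] C) (l : ι → ν) (hl : ∀ i, ∀ a ∈ N (R i), γ a ∈ P (Q (l i)))
    (h₁ : ∀ i, k (f i) = l i) (h₂ : ∀ a, β (α a) = γ a) (x : NetProduct N R) :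
    map (N := M) (M := P) β k hk (map (N := N) (M := M) α f h x) = map γ l hl x := by
  have : (map (N := M) (M := P) (S := Q) β k hk).comp (map (N := N) (M := M) α f h)
      = map γ l hl := hom_ext fun i a ha => by
    simp only [StarAlgHom.comp_apply, map_letter]
    exact letter_congr (h₁ i) (h₂ a) _ _
  exact DFunLike.congr_fun this x

theorem map_id (f : ι → ι) (h : ∀ i, ∀ a ∈ N (R i), StarAlgHom.id ℂ A a ∈ N (R (f i)))
    (hf : ∀ i, f i = i) (x : NetProduct N R) : map (StarAlgHom.id ℂ A) f h x = x := by
  have : map (StarAlgHom.id ℂ A) f h = StarAlgHom.id ℂ _ := hom_ext fun i a ha => by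
    rw [map_letter]
    exact letter_congr (hf i) rfl _ _
  exact DFunLike.congr_fun this x

end NetProduct

/-- The free product `A_U ⁎ A_V`. -/
abbrev PairProduct (N : Set L → StarSubalgebra ℂ A) (U V : Set L) : Type w₁ :=
  NetProduct N fun b : Bool => cond b U V

/-- The two-sided ideal `[A_U, A_V]` of `A_U ⁎ A_V` generated by the commutators `a b - b a` with
`a ∈ A_U` and `b ∈ A_V`. -/
def commutatorIdeal (N : Set L → StarSubalgebra ℂ A) (U V : Set L) :
    TwoSidedIdeal (PairProduct N U V) :=
  TwoSidedIdeal.span {x | ∃ (a b : A) (ha : a ∈ N U) (hb : b ∈ N V),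
    x = NetProduct.letter N (fun b : Bool => cond b U V) true a ha
          * NetProduct.letter N (fun b : Bool => cond b U V) false b hb
        - NetProduct.letter N (fun b : Bool => cond b U V) false b hb
          * NetProduct.letter N (fun b : Bool => cond b U V) true a ha}

/-- `δ`-local commutativity: if `d(U, V) > δ`, the kernel of `A_U ⁎ A_V → A` is `[A_U, A_V]`. -/
def LocallyCommutative [MetricSpace L] (N : Set L → StarSubalgebra ℂ A) (δ : ℝ≥0) : Prop :=
  ∀ U V : Set L, (δ : ℝ≥0∞) < setEDist U V → ∀ x : PairProduct N U V,
    NetProduct.eval N (fun b : Bool => cond b U V) x = 0 ↔ x ∈ commutatorIdeal N U V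

end Net

/-- A quasi-local `*`-algebra over `L`: a unital `*`-algebra `A` with a net of local `*`-subalgebras
`U ↦ A_U` indexed by the subsets of `L`. -/
structure QuasiLocalAlgebra (L : Type u) [MetricSpace L] where
  carrier : Type w
  [instRing : Ring carrier]
  [instStarRing : StarRing carrier]
  [instAlgebra : Algebra ℂ carrier]
  [instStarModule : StarModule ℂ carrier]
  net : Set L → StarSubalgebra ℂ carrier
  net_univ : net Set.univ = ⊤
  net_mono : ∀ {U V : Set L}, U ⊆ V → net U ≤ net V
  /-- Finite determination: `A_U` is the union of the `A_V` over the finite subsets `V` of `U`. -/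
  finite_determination : ∀ (U : Set L), ∀ a ∈ net U, ∃ V : Set L, V ⊆ U ∧ V.Finite ∧ a ∈ net V
  local_commutativity : ∃ δ : ℝ≥0, LocallyCommutative net δ
  /-- Weak algebraic Haag duality: the centralizer of `A_{Fᶜ}` lies in `A_{F⁺ᵞ}` for balls `F` of
  diameter at least `R`. -/
  haag_duality : ∃ R γ : ℝ≥0, ∀ (x : L) (r : ℝ), 0 < r →
    (R : ℝ≥0∞) ≤ Metric.ediam (Metric.ball x r) →
    ∀ a : carrier, (∀ b ∈ net (Metric.ball x r)ᶜ, a * b = b * a) →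
      a ∈ net (nbhd γ (Metric.ball x r))

attribute [instance] QuasiLocalAlgebra.instRing QuasiLocalAlgebra.instStarRing
  QuasiLocalAlgebra.instAlgebra QuasiLocalAlgebra.instStarModule

namespace QuasiLocalAlgebra

variable {L : Type u} [MetricSpace L] (A : QuasiLocalAlgebra.{u, w} L)

/-- The free product of the local algebras `A_V` over all `V ∈ 𝔉_D(U)`. -/
abbrev LocalProduct (D : ℝ≥0) (U : Set L) : Type (max u w) :=
  NetProduct A.net fun V : Region D U => V.1

/-- The canonical map from the free product over `𝔉_D(U)` to `A`. -/
abbrev eval (D : ℝ≥0) (U : Set L) : A.LocalProduct D U →⋆ₐ[ℂ] A.carrier :=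
  NetProduct.eval A.net fun V : Region D U => V.1

/-- The canonical map from the free product over `𝔉_D(U)` to the one over `𝔉_{D₁}(U₁)`. -/
def incl {D D₁ : ℝ≥0} {U U₁ : Set L} (hD : D ≤ D₁) (hU : U ⊆ U₁) :
    A.LocalProduct D U →⋆ₐ[ℂ] A.LocalProduct D₁ U₁ :=
  NetProduct.map (StarAlgHom.id ℂ A.carrier) (Region.incl hD hU) fun _ _ ha => ha

/-- The canonical map `A_V ⁎ A_W → ⁎_{𝔉_D(U)} A` for `V, W ∈ 𝔉_D(U)`. -/
def pairIncl {D : ℝ≥0} {U : Set L} (V W : Region D U) :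
    PairProduct A.net V.1 W.1 →⋆ₐ[ℂ] A.LocalProduct D U :=
  NetProduct.map (StarAlgHom.id ℂ A.carrier) (fun b : Bool => cond b V W) fun b _ ha => by
    cases b <;> exact ha

/-- The ideal of the free product over `𝔉_D(U)` generated by the kernels of `A_V ⁎ A_W → A` for
those pairs `V, W ∈ 𝔉_D(U)` that satisfy `P`. -/
def pairIdeal {D : ℝ≥0} {U : Set L} (P : Region D U → Region D U → Prop) :
    TwoSidedIdeal (A.LocalProduct D U) :=
  TwoSidedIdeal.span {y | ∃ V W : Region D U, P V W ∧ ∃ x : PairProduct A.net V.1 W.1,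
    NetProduct.eval A.net (fun b : Bool => cond b V.1 W.1) x = 0 ∧ y = A.pairIncl V W x}

/-- `A` is locally generated with parameters `D, r`: the image of the free product over
`𝔉_D(U⁺ʳ)` contains `A_U`, for every `U`. -/
def LocallyGenerated (D r : ℝ≥0) : Prop :=
  ∀ U : Set L, ∀ a ∈ A.net U, ∃ x : A.LocalProduct D (nbhd r U), A.eval D (nbhd r U) x = a

/-- `A` is (weakly) locally presented with parameters `D ≤ T`, `r ≤ t`: it is locally generated with
parameters `D, r`, and the kernel of the map from the free product over `𝔉_D(U⁺ʳ)` to `A` is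
contained in the ideal of the free product over `𝔉_T(U⁺ᵗ)` generated by the kernels of
`A_V ⁎ A_W → A` for all `V, W ∈ 𝔉_T(U⁺ᵗ)`, for every `U`. -/
def LocallyPresented (D r T t : ℝ≥0) : Prop :=
  A.LocallyGenerated D r ∧ ∃ (hD : D ≤ T) (hr : r ≤ t), ∀ U : Set L,
    ∀ x : A.LocalProduct D (nbhd r U), A.eval D (nbhd r U) x = 0 →
      A.incl hD (nbhd_mono hr U) x
        ∈ A.pairIdeal (D := T) (U := nbhd t U) fun _ _ => True

/-- `A` is (weakly) locally presented. -/
def IsLocallyPresented : Prop := ∃ D r T t : ℝ≥0, A.LocallyPresented D r T t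

/-- The parameters on which the compactified algebra depends: `δ` such that `A` is `δ`-locally
commutative, and `D, T` such that `A` is locally presented with parameters `D, T` (and some
`r, t`). They are ordered componentwise. -/
structure Param where
  δ : ℝ≥0
  D : ℝ≥0
  T : ℝ≥0
  comm : LocallyCommutative A.net δ
  pres : ∃ r t : ℝ≥0, A.LocallyPresented D r T t

namespace Param

variable {A}

instance : PartialOrder A.Param where
  le p q := p.δ ≤ q.δ ∧ p.D ≤ q.D ∧ p.T ≤ q.T
  le_refl _ := ⟨le_rfl, le_rfl, le_rfl⟩
  le_trans _ _ _ h k := ⟨h.1.trans k.1, h.2.1.trans k.2.1, h.2.2.trans k.2.2⟩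
  le_antisymm p q h k := by
    cases p
    cases q
    obtain ⟨h₁, h₂, h₃⟩ := h
    obtain ⟨k₁, k₂, k₃⟩ := k
    congr
    · exact le_antisymm h₁ k₁
    · exact le_antisymm h₂ k₂
    · exact le_antisymm h₃ k₃

theorem D_le_T (p : A.Param) : p.D ≤ p.T := by
  obtain ⟨r, t, -, hD, -⟩ := p.pres
  exact hD

end Param

end QuasiLocalAlgebra

/-- A `G`-covariant quasi-local `*`-algebra over `L`. -/
structure CovariantQuasiLocalAlgebra {L : Type u} [MetricSpace L] (G : Subgroup (L ≃ᵢ L)) extends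
    QuasiLocalAlgebra.{u, w} L where
  action : G →* (carrier ≃⋆ₐ[ℂ] carrier)
  action_net : ∀ (g : G) (U : Set L),
    action g '' (net U : Set carrier) = (net ((g : L ≃ᵢ L) '' U) : Set carrier)

namespace CovariantQuasiLocalAlgebra

variable {L : Type u} [MetricSpace L] {G₀ : Subgroup (L ≃ᵢ L)}

theorem action_mem (A : CovariantQuasiLocalAlgebra.{u, w} G₀) (g : G₀) {U : Set L} {a : A.carrier}
    (ha : a ∈ A.net U) : A.action g a ∈ A.net ((g : L ≃ᵢ L) '' U) := by
  have : A.action g a ∈ (A.net ((g : L ≃ᵢ L) '' U) : Set A.carrier) := by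
    rw [← A.action_net]
    exact ⟨a, ha, rfl⟩
  exact this

/-- `α` has spread at most `s`: it maps `A_U` into `B_{U⁺ˢ}` for all finite `U`. -/
def HasSpread {A B : CovariantQuasiLocalAlgebra.{u, w} G₀} (α : A.carrier →⋆ₐ[ℂ] B.carrier)
    (s : ℝ≥0) : Prop :=
  ∀ U : Set L, U.Finite → ∀ a ∈ A.net U, α a ∈ B.net (nbhd s U)

theorem HasSpread.mem {A B : CovariantQuasiLocalAlgebra.{u, w} G₀}
    {α : A.carrier →⋆ₐ[ℂ] B.carrier} {s : ℝ≥0} (h : HasSpread α s) (U : Set L) (a : A.carrier)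
    (ha : a ∈ A.net U) : α a ∈ B.net (nbhd s U) := by
  obtain ⟨V, hVU, hV, haV⟩ := A.finite_determination U a ha
  exact B.net_mono (Metric.cthickening_subset_of_subset _ hVU) (h V hV a haV)

/-- Equivariant bounded-spread `*`-homomorphisms. -/
@[ext]
structure Hom (A B : CovariantQuasiLocalAlgebra.{u, w} G₀) where
  toHom : A.carrier →⋆ₐ[ℂ] B.carrier
  bounded_spread : ∃ s : ℝ≥0, HasSpread toHom s
  equivariant : ∀ (g : G₀) (a : A.carrier), toHom (A.action g a) = B.action g (toHom a)

/-- The category of `G`-covariant quasi-local `*`-algebras and `G`-equivariant bounded-spread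
`*`-homomorphisms. -/
instance : Category (CovariantQuasiLocalAlgebra.{u, w} G₀) where
  Hom := Hom
  id A :=
    { toHom := StarAlgHom.id ℂ A.carrier
      bounded_spread := ⟨0, fun U _ _ ha => A.net_mono (Metric.self_subset_cthickening U) ha⟩
      equivariant := fun _ _ => rfl }
  comp {A B C} α β :=
    { toHom := β.toHom.comp α.toHom
      bounded_spread := by
        obtain ⟨s, hs⟩ := α.bounded_spread
        obtain ⟨t, ht⟩ := β.bounded_spread
        refine ⟨t + s, fun U hU a ha => ?_⟩
        refine C.net_mono ?_ (ht.mem _ _ (hs U hU a ha))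
        exact Metric.cthickening_cthickening_subset t.2 s.2 U
      equivariant := fun g a => by
        simp only [StarAlgHom.comp_apply, α.equivariant, β.equivariant] }

/-! ### Compactified algebras -/

variable (A : CovariantQuasiLocalAlgebra.{u, w} G₀)

/-- The letter `a ∈ A_V`, for `V ∈ 𝔉_T(L)`, in the free product over `𝔉_T(L)`. -/
abbrev letter {T : ℝ≥0} (V : Region T (Set.univ : Set L)) (a : A.carrier) (ha : a ∈ A.net V.1) :
    A.LocalProduct T Set.univ :=
  NetProduct.letter A.net (fun V : Region T (Set.univ : Set L) => V.1) V a ha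

/-- The local relations: the kernels of `A_V ⁎ A_W → A` with `d(V, W) ≤ δ`. -/
def locIdeal (δ T : ℝ≥0) : TwoSidedIdeal (A.LocalProduct T (Set.univ : Set L)) :=
  A.pairIdeal fun V W => setEDist V.1 W.1 ≤ δ

/-- The `G`-distant relations: the commutators `[A_V, A_W]` with `d(GV, GW) > δ`. -/
def distIdeal (G : Subgroup G₀) (δ T : ℝ≥0) :
    TwoSidedIdeal (A.LocalProduct T (Set.univ : Set L)) :=
  TwoSidedIdeal.span {y | ∃ V W : Region T (Set.univ : Set L),
    (δ : ℝ≥0∞) < setEDist (orbitUnion G V.1) (orbitUnion G W.1) ∧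
    ∃ (a b : A.carrier) (ha : a ∈ A.net V.1) (hb : b ∈ A.net W.1),
      y = A.letter V a ha * A.letter W b hb - A.letter W b hb * A.letter V a ha}

/-- The `G`-orbital relations, which identify `a ∈ A_V` with `g a ∈ A_{gV}` for `g ∈ G`. -/
def orbIdeal (G : Subgroup G₀) (T : ℝ≥0) : TwoSidedIdeal (A.LocalProduct T (Set.univ : Set L)) :=
  TwoSidedIdeal.span {y | ∃ (V : Region T (Set.univ : Set L)) (g : G₀), g ∈ G ∧
    ∃ (a : A.carrier) (ha : a ∈ A.net V.1),
      y = A.letter V a ha - A.letter (V.translate g) (A.action g a) (A.action_mem g ha)}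

/-- The sum of the ideals of local, `G`-distant and `G`-orbital relations. -/
def cptIdeal (G : Subgroup G₀) (δ T : ℝ≥0) :
    TwoSidedIdeal (A.LocalProduct T (Set.univ : Set L)) :=
  A.locIdeal δ T ⊔ A.distIdeal G δ T ⊔ A.orbIdeal G T

theorem star_letter {T : ℝ≥0} (V : Region T (Set.univ : Set L)) (a : A.carrier)
    (ha : a ∈ A.net V.1) : star (A.letter V a ha) = A.letter V (star a) (star_mem ha) :=
  (map_star (StarFreeProduct.of (fun V : Region T (Set.univ : Set L) => A.net V.1) V) ⟨a, ha⟩).symm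

instance (δ T : ℝ≥0) : (A.locIdeal δ T).IsStarClosed :=
  TwoSidedIdeal.isStarClosed_span fun y hy => by
    obtain ⟨V, W, h, x, hx, rfl⟩ := hy
    exact ⟨V, W, h, star x, by rw [map_star, hx, star_zero], (map_star _ x).symm⟩

instance (G : Subgroup G₀) (δ T : ℝ≥0) : (A.distIdeal G δ T).IsStarClosed :=
  TwoSidedIdeal.isStarClosed_span fun y hy => by
    obtain ⟨V, W, h, a, b, ha, hb, rfl⟩ := hy
    refine ⟨W, V, ?_, star b, star a, star_mem hb, star_mem ha, ?_⟩
    · refine h.trans_le (le_setEDist fun x hx y hy => ?_)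
      rw [edist_comm]
      exact setEDist_le hy hx
    · rw [star_sub, star_mul, star_mul, star_letter, star_letter]

instance (G : Subgroup G₀) (T : ℝ≥0) : (A.orbIdeal G T).IsStarClosed :=
  TwoSidedIdeal.isStarClosed_span fun y hy => by
    obtain ⟨V, g, hg, a, ha, rfl⟩ := hy
    refine ⟨V, g, hg, star a, star_mem ha, ?_⟩
    rw [star_sub, star_letter, star_letter]
    congr 1
    exact NetProduct.letter_congr rfl (map_star (A.action g) a).symm _ _

instance (G : Subgroup G₀) (δ T : ℝ≥0) : (A.cptIdeal G δ T).IsStarClosed :=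
  inferInstanceAs (A.locIdeal δ T ⊔ A.distIdeal G δ T ⊔ A.orbIdeal G T).IsStarClosed

/-- The contraction of `cptIdeal` to the free product over `𝔉_D(L)`. -/
def contractedIdeal (G : Subgroup G₀) (p : A.Param) :
    TwoSidedIdeal (A.LocalProduct p.D (Set.univ : Set L)) :=
  (A.cptIdeal G p.δ p.T).comap (A.incl p.D_le_T subset_rfl)

instance (G : Subgroup G₀) (p : A.Param) : (A.contractedIdeal G p).IsStarClosed :=
  TwoSidedIdeal.isStarClosed_comap _ _

/-- The compactified algebra `Cpt_{D,T}^G(A, δ)`. -/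
abbrev Cpt (G : Subgroup G₀) (p : A.Param) : Type (max u w) := StarQuotient (A.contractedIdeal G p)

/-! ### The induced maps of compactified algebras -/

section Maps

variable [BoundedGeometry L] {A B C : CovariantQuasiLocalAlgebra.{u, w} G₀}

/-- The map of free products over `𝔉_D(L)` and `𝔉_{D₁}(L)` induced by a `*`-homomorphism `α` with
`α(A_U) ⊆ B_{e U}`: it sends the letter `a ∈ A_V` to the letter `α a ∈ B_{e V}`. -/
def localMap (α : A.carrier →⋆ₐ[ℂ] B.carrier) {s : ℝ≥0} (e : Enlargement L s)
    (he : ∀ U, ∀ a ∈ A.net U, α a ∈ B.net (e.toFun U)) {D D₁ : ℝ≥0} (hD : D + 2 * s ≤ D₁) :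
    A.LocalProduct D (Set.univ : Set L) →⋆ₐ[ℂ] B.LocalProduct D₁ (Set.univ : Set L) :=
  NetProduct.map α (e.mapRegion hD) fun V a ha => he V.1 a ha

theorem localMap_letter (α : A.carrier →⋆ₐ[ℂ] B.carrier) {s : ℝ≥0} (e : Enlargement L s)
    (he : ∀ U, ∀ a ∈ A.net U, α a ∈ B.net (e.toFun U)) {D D₁ : ℝ≥0} (hD : D + 2 * s ≤ D₁)
    (V : Region D (Set.univ : Set L)) (a : A.carrier) (ha : a ∈ A.net V.1) :
    localMap α e he hD (A.letter V a ha) = B.letter (e.mapRegion hD V) (α a) (he V.1 a ha) :=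
  NetProduct.map_letter _ _ _ _ _ _

theorem incl_letter {D T : ℝ≥0} (hD : D ≤ T) (V : Region D (Set.univ : Set L)) (a : A.carrier)
    (ha : a ∈ A.net V.1) :
    A.incl hD subset_rfl (A.letter V a ha) = A.letter (V.incl hD subset_rfl) a ha :=
  NetProduct.map_letter _ _ _ _ _ _

theorem pairIncl_true {T : ℝ≥0} (V W : Region T (Set.univ : Set L)) (a : A.carrier)
    (ha : a ∈ A.net V.1) :
    A.pairIncl V W (NetProduct.letter A.net (fun b : Bool => cond b V.1 W.1) true a ha)
      = A.letter V a ha :=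
  NetProduct.map_letter _ _ _ _ _ _

theorem pairIncl_false {T : ℝ≥0} (V W : Region T (Set.univ : Set L)) (a : A.carrier)
    (ha : a ∈ A.net W.1) :
    A.pairIncl V W (NetProduct.letter A.net (fun b : Bool => cond b V.1 W.1) false a ha)
      = A.letter W a ha :=
  NetProduct.map_letter _ _ _ _ _ _

theorem letter_commutator_mem_locIdeal {δ T : ℝ≥0} (V W : Region T (Set.univ : Set L))
    (h : setEDist V.1 W.1 ≤ δ) (a b : A.carrier) (ha : a ∈ A.net V.1) (hb : b ∈ A.net W.1)
    (hab : a * b = b * a) :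
    A.letter V a ha * A.letter W b hb - A.letter W b hb * A.letter V a ha ∈ A.locIdeal δ T := by
  refine TwoSidedIdeal.subset_span ⟨V, W, h,
    NetProduct.letter A.net (fun b : Bool => cond b V.1 W.1) true a ha
      * NetProduct.letter A.net (fun b : Bool => cond b V.1 W.1) false b hb
    - NetProduct.letter A.net (fun b : Bool => cond b V.1 W.1) false b hb
      * NetProduct.letter A.net (fun b : Bool => cond b V.1 W.1) true a ha, ?_, ?_⟩
  · simp only [map_sub, map_mul, NetProduct.eval_letter, hab, sub_self]
  · rw [map_sub, map_mul, map_mul, pairIncl_true, pairIncl_false]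

theorem commute_of_lt_setEDist {δ : ℝ≥0} (hδ : LocallyCommutative A.net δ) {U V : Set L}
    (h : (δ : ℝ≥0∞) < setEDist U V) {a b : A.carrier} (ha : a ∈ A.net U) (hb : b ∈ A.net V) :
    a * b = b * a := by
  have h1 := (hδ U V h _).2 (TwoSidedIdeal.subset_span ⟨a, b, ha, hb, rfl⟩)
  rw [map_sub, map_mul, map_mul, NetProduct.eval_letter, NetProduct.eval_letter,
    sub_eq_zero] at h1
  exact h1

theorem letter_commutator_mem_distIdeal (G : Subgroup G₀) {δ T : ℝ≥0}
    (V W : Region T (Set.univ : Set L))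
    (h : (δ : ℝ≥0∞) < setEDist (orbitUnion G V.1) (orbitUnion G W.1)) (a b : A.carrier)
    (ha : a ∈ A.net V.1) (hb : b ∈ A.net W.1) :
    A.letter V a ha * A.letter W b hb - A.letter W b hb * A.letter V a ha
      ∈ A.distIdeal G δ T :=
  TwoSidedIdeal.subset_span ⟨V, W, h, a, b, ha, hb, rfl⟩

theorem letter_sub_mem_orbIdeal (G : Subgroup G₀) {T : ℝ≥0} (V : Region T (Set.univ : Set L))
    (g : G₀) (hg : g ∈ G) (a : A.carrier) (ha : a ∈ A.net V.1) :
    A.letter V a ha - A.letter (V.translate g) (A.action g a) (A.action_mem g ha)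
      ∈ A.orbIdeal G T :=
  TwoSidedIdeal.subset_span ⟨V, g, hg, a, ha, rfl⟩

theorem locIdeal_le (G : Subgroup G₀) (δ T : ℝ≥0) : A.locIdeal δ T ≤ A.cptIdeal G δ T :=
  le_sup_left.trans le_sup_left

theorem distIdeal_le (G : Subgroup G₀) (δ T : ℝ≥0) : A.distIdeal G δ T ≤ A.cptIdeal G δ T :=
  le_sup_right.trans le_sup_left

theorem orbIdeal_le (G : Subgroup G₀) (δ T : ℝ≥0) : A.orbIdeal G T ≤ A.cptIdeal G δ T :=
  le_sup_right

theorem sub_mem_of_replace {R : Type v} [Ring R] (I : TwoSidedIdeal R) {x y z : R}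
    (h₁ : y - z ∈ I) (h₂ : x * z - z * x ∈ I) : x * y - y * x ∈ I := by
  have h : x * y - y * x = x * (y - z) - (y - z) * x + (x * z - z * x) := by noncomm_ring
  rw [h]
  exact add_mem (sub_mem (TwoSidedIdeal.mul_mem_left _ _ _ h₁)
    (TwoSidedIdeal.mul_mem_right _ _ _ h₁)) h₂

/-- Letters commute modulo the relations if the first commutes, in the algebra, with all translates
of the second to the `δ`-neighbourhood of the first. -/
theorem letter_commutator_mem_cptIdeal (G : Subgroup G₀) {δ T : ℝ≥0}
    (V W : Region T (Set.univ : Set L)) (a b : A.carrier) (ha : a ∈ A.net V.1) (hb : b ∈ A.net W.1)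
    (h : ∀ g ∈ G, setEDist V.1 ((g : L ≃ᵢ L) '' W.1) ≤ δ →
      a * A.action g b = A.action g b * a) :
    A.letter V a ha * A.letter W b hb - A.letter W b hb * A.letter V a ha
      ∈ A.cptIdeal G δ T := by
  by_cases hd : (δ : ℝ≥0∞) < setEDist (orbitUnion G V.1) (orbitUnion G W.1)
  · exact distIdeal_le G δ T (letter_commutator_mem_distIdeal G V W hd a b ha hb)
  · obtain ⟨g, hg, hgd⟩ := exists_setEDist_image_le G V.ediam_le (not_lt.1 hd)
    have h1 := letter_commutator_mem_locIdeal V (W.translate g) hgd a (A.action g b) ha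
      (A.action_mem g hb) (h g hg hgd)
    exact sub_mem_of_replace _
      (orbIdeal_le G δ T (letter_sub_mem_orbIdeal G W g hg b hb)) (locIdeal_le G δ T h1)

/-- The map `A_U ⁎ A_V → B_{U₁} ⁎ B_{V₁}` induced by `α`. -/
def pairMap (α : A.carrier →⋆ₐ[ℂ] B.carrier) {U V U₁ V₁ : Set L}
    (hU : ∀ a ∈ A.net U, α a ∈ B.net U₁) (hV : ∀ a ∈ A.net V, α a ∈ B.net V₁) :
    PairProduct A.net U V →⋆ₐ[ℂ] PairProduct B.net U₁ V₁ :=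
  NetProduct.map α id fun b a ha => by
    cases b
    · exact hV a ha
    · exact hU a ha

theorem eval_pairMap (α : A.carrier →⋆ₐ[ℂ] B.carrier) {U V U₁ V₁ : Set L}
    (hU : ∀ a ∈ A.net U, α a ∈ B.net U₁) (hV : ∀ a ∈ A.net V, α a ∈ B.net V₁)
    (x : PairProduct A.net U V) :
    NetProduct.eval B.net (fun b : Bool => cond b U₁ V₁) (pairMap α hU hV x)
      = α (NetProduct.eval A.net (fun b : Bool => cond b U V) x) :=
  NetProduct.eval_map _ _ _ _

theorem pairIncl_pairMap (α : A.carrier →⋆ₐ[ℂ] B.carrier) {s : ℝ≥0} (e : Enlargement L s)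
    (he : ∀ U, ∀ a ∈ A.net U, α a ∈ B.net (e.toFun U)) {T T₁ : ℝ≥0}
    (hT : T + 2 * s ≤ T₁) (V W : Region T (Set.univ : Set L)) (x : PairProduct A.net V.1 W.1) :
    B.pairIncl (e.mapRegion hT V) (e.mapRegion hT W) (pairMap α (he V.1) (he W.1) x)
      = localMap α e he hT (A.pairIncl V W x) := by
  have key : (B.pairIncl (e.mapRegion hT V) (e.mapRegion hT W)).comp
      (pairMap α (he V.1) (he W.1)) = (localMap α e he hT).comp (A.pairIncl V W) := by
    refine NetProduct.hom_ext fun b a ha => ?_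
    rw [StarAlgHom.comp_apply, StarAlgHom.comp_apply]
    have h1 : pairMap α (he V.1) (he W.1) (NetProduct.letter A.net _ b a ha) = _ :=
      NetProduct.map_letter _ _ _ _ _ _
    rw [h1]
    cases b
    · refine (pairIncl_false (e.mapRegion hT V) (e.mapRegion hT W) _ _).trans ?_
      refine ((congrArg _ (pairIncl_false V W a ha)).trans ?_).symm
      exact localMap_letter _ _ _ _ _ _ _
    · refine (pairIncl_true (e.mapRegion hT V) (e.mapRegion hT W) _ _).trans ?_
      refine ((congrArg _ (pairIncl_true V W a ha)).trans ?_).symm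
      exact localMap_letter _ _ _ _ _ _ _
  exact DFunLike.congr_fun key x

theorem pairIncl_mem_locIdeal {δ T : ℝ≥0} (V W : Region T (Set.univ : Set L))
    (h : setEDist V.1 W.1 ≤ δ) (x : PairProduct A.net V.1 W.1)
    (hx : NetProduct.eval A.net (fun b : Bool => cond b V.1 W.1) x = 0) :
    A.pairIncl V W x ∈ A.locIdeal δ T :=
  TwoSidedIdeal.subset_span ⟨V, W, h, x, hx, rfl⟩

theorem map_pairIncl_mem (α : A ⟶ B) {s : ℝ≥0} (e : Enlargement L s)
    (he : ∀ U, ∀ a ∈ A.net U, α.toHom a ∈ B.net (e.toFun U)) {δ δ₁ T T₁ : ℝ≥0}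
    (hδ : δ ≤ δ₁) (hT : T + 2 * s ≤ T₁) (V W : Region T (Set.univ : Set L))
    (h : setEDist V.1 W.1 ≤ δ) (x : PairProduct A.net V.1 W.1)
    (hx : NetProduct.eval A.net (fun b : Bool => cond b V.1 W.1) x = 0) :
    localMap α.toHom e he hT (A.pairIncl V W x) ∈ B.locIdeal δ₁ T₁ := by
  rw [← pairIncl_pairMap]
  refine pairIncl_mem_locIdeal _ _ ?_ _ ?_
  · exact (setEDist_anti (e.subset _) (e.subset _)).trans
      (h.trans (ENNReal.coe_le_coe.2 hδ))
  · rw [eval_pairMap, hx, map_zero]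

/-- The induced map respects the relations. -/
theorem map_mem_cptIdeal (G : Subgroup G₀) (α : A ⟶ B) {s : ℝ≥0} (e : Enlargement L s)
    (he : ∀ U, ∀ a ∈ A.net U, α.toHom a ∈ B.net (e.toFun U)) {δ δ₁ T T₁ : ℝ≥0}
    (hc : LocallyCommutative A.net δ) (hδ : δ ≤ δ₁) (hT : T + 2 * s ≤ T₁)
    {x : A.LocalProduct T (Set.univ : Set L)} (hx : x ∈ A.cptIdeal G δ T) :
    localMap α.toHom e he hT x ∈ B.cptIdeal G δ₁ T₁ := by
  rw [← TwoSidedIdeal.mem_comap (localMap α.toHom e he hT)]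
  refine (sup_le (sup_le ?_ ?_) ?_ :
    A.cptIdeal G δ T ≤ (B.cptIdeal G δ₁ T₁).comap (localMap α.toHom e he hT)) hx
  · refine TwoSidedIdeal.span_le.2 ?_
    rintro _ ⟨V, W, h, x, hx, rfl⟩
    exact (TwoSidedIdeal.mem_comap (localMap α.toHom e he hT)).2
      (locIdeal_le G _ _ (map_pairIncl_mem α e he hδ hT V W h x hx))
  · refine TwoSidedIdeal.span_le.2 ?_
    rintro _ ⟨V, W, h, a, b, ha, hb, rfl⟩
    refine (TwoSidedIdeal.mem_comap (localMap α.toHom e he hT)).2 ?_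
    rw [map_sub, map_mul, map_mul, localMap_letter, localMap_letter]
    refine letter_commutator_mem_cptIdeal G (e.mapRegion hT V) (e.mapRegion hT W) (α.toHom a)
      (α.toHom b) (he V.1 a ha) (he W.1 b hb) fun g hg _ => ?_
    have h1 : a * A.action g b = A.action g b * a := commute_of_lt_setEDist hc
      (h.trans_le (setEDist_orbitUnion_le hg _ _)) ha (A.action_mem g hb)
    rw [← α.equivariant, ← map_mul, h1, map_mul]
  · refine TwoSidedIdeal.span_le.2 ?_
    rintro _ ⟨V, g, hg, a, ha, rfl⟩
    refine (TwoSidedIdeal.mem_comap (localMap α.toHom e he hT)).2 ?_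
    rw [map_sub, localMap_letter, localMap_letter]
    have h1 : B.letter (e.mapRegion hT (V.translate g)) (α.toHom (A.action g a))
        (he _ _ (A.action_mem g ha)) = B.letter ((e.mapRegion hT V).translate g)
          (B.action g (α.toHom a)) (B.action_mem g (he V.1 a ha)) :=
      NetProduct.letter_congr (Region.ext (e.image _ _)) (α.equivariant g a) _ _
    rw [h1]
    exact orbIdeal_le G _ _ (letter_sub_mem_orbIdeal G _ g hg _ _)

theorem incl_localMap (α : A ⟶ B) {s : ℝ≥0} (e : Enlargement L s)
    (he : ∀ U, ∀ a ∈ A.net U, α.toHom a ∈ B.net (e.toFun U)) {D T D₁ T₁ : ℝ≥0}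
    (hDT : D ≤ T) (hDT₁ : D₁ ≤ T₁) (hD : D + 2 * s ≤ D₁) (hT : T + 2 * s ≤ T₁)
    (x : A.LocalProduct D (Set.univ : Set L)) :
    B.incl hDT₁ subset_rfl (localMap α.toHom e he hD x)
      = localMap α.toHom e he hT (A.incl hDT subset_rfl x) := by
  have key : (B.incl hDT₁ subset_rfl).comp (localMap α.toHom e he hD)
      = (localMap α.toHom e he hT).comp (A.incl hDT subset_rfl) := by
    refine NetProduct.hom_ext fun V a ha => ?_
    rw [StarAlgHom.comp_apply, StarAlgHom.comp_apply, localMap_letter, incl_letter, incl_letter,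
      localMap_letter]
  exact DFunLike.congr_fun key x

theorem map_mem_contractedIdeal (G : Subgroup G₀) (α : A ⟶ B) {s : ℝ≥0} (e : Enlargement L s)
    (he : ∀ U, ∀ a ∈ A.net U, α.toHom a ∈ B.net (e.toFun U)) (p : A.Param) (q : B.Param)
    (hδ : p.δ ≤ q.δ) (hD : p.D + 2 * s ≤ q.D) (hT : p.T + 2 * s ≤ q.T)
    {x : A.LocalProduct p.D (Set.univ : Set L)} (hx : x ∈ A.contractedIdeal G p) :
    localMap α.toHom e he hD x ∈ B.contractedIdeal G q := by
  have h := map_mem_cptIdeal G α e he p.comm hδ hT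
    ((TwoSidedIdeal.mem_comap (A.incl p.D_le_T subset_rfl)).1 hx)
  rw [← incl_localMap α e he p.D_le_T q.D_le_T hD hT] at h
  exact (TwoSidedIdeal.mem_comap (B.incl q.D_le_T subset_rfl)).2 h

/-- The `*`-homomorphism `Cpt_{D,T}^G(A, δ) → Cpt_{D₁,T₁}^G(B, δ₁)` induced by `α`. -/
def cptMap (G : Subgroup G₀) (α : A ⟶ B) {s : ℝ≥0} (e : Enlargement L s)
    (he : ∀ U, ∀ a ∈ A.net U, α.toHom a ∈ B.net (e.toFun U)) (p : A.Param) (q : B.Param)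
    (hδ : p.δ ≤ q.δ) (hD : p.D + 2 * s ≤ q.D) (hT : p.T + 2 * s ≤ q.T) :
    A.Cpt G p →⋆ₐ[ℂ] B.Cpt G q :=
  StarQuotient.lift _ ((StarQuotient.mk _).comp (localMap α.toHom e he hD)) fun _ hx =>
    (StarQuotient.mk_eq_zero_iff _).2 (map_mem_contractedIdeal G α e he p q hδ hD hT hx)

end Maps

end CovariantQuasiLocalAlgebra

/-! ### Products modulo direct sums -/

section ReducedProduct

variable {Λ : Type v} (X : Λ → Type w) [∀ l, Ring (X l)] [∀ l, StarRing (X l)]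
  [∀ l, Algebra ℂ (X l)] [∀ l, StarModule ℂ (X l)]

/-- The direct sum `⨁_λ X_λ`, as an ideal of the product `∏_λ X_λ`. -/
def directSumIdeal : TwoSidedIdeal (∀ l, X l) :=
  TwoSidedIdeal.mk' {x | {l | x l ≠ 0}.Finite} (by simp)
    (fun {x y} hx hy => (Set.Finite.union hx hy).subset fun l hl => by
      by_contra h
      simp only [Set.mem_union, Set.mem_ofPred_eq, not_or, not_not] at h
      exact hl (by simp [h.1, h.2]))
    (fun {x} hx => Set.Finite.subset hx fun l hl => by simpa using hl)
    (fun {x y} hy => Set.Finite.subset hy fun l hl h => hl (by simp [h]))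
    (fun {x y} hx => Set.Finite.subset hx fun l hl h => hl (by simp [h]))

theorem mem_directSumIdeal {x : ∀ l, X l} : x ∈ directSumIdeal X ↔ {l | x l ≠ 0}.Finite :=
  TwoSidedIdeal.mem_mk' _ _ _ _ _ _ x

instance : (directSumIdeal X).IsStarClosed where
  star_mem x hx := by
    rw [mem_directSumIdeal] at hx ⊢
    exact hx.subset fun l hl h => hl (by simp [h])

/-- The `*`-algebra `∏_λ X_λ / ⨁_λ X_λ`. -/
abbrev ReducedProduct : Type (max v w) := StarQuotient (directSumIdeal X)

variable {X} {Y : Λ → Type w} [∀ l, Ring (Y l)] [∀ l, StarRing (Y l)]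
  [∀ l, Algebra ℂ (Y l)] [∀ l, StarModule ℂ (Y l)]

/-- A family of `*`-homomorphisms induces a `*`-homomorphism of the products. -/
def piMap (f : ∀ l, X l →⋆ₐ[ℂ] Y l) : (∀ l, X l) →⋆ₐ[ℂ] (∀ l, Y l) where
  toFun x l := f l (x l)
  map_one' := by ext; simp
  map_mul' _ _ := by ext; simp
  map_zero' := by ext; simp
  map_add' _ _ := by ext; simp
  commutes' r := by ext; simp [Pi.algebraMap_apply, AlgHomClass.commutes]
  map_star' _ := by ext; simp [map_star]

/-- A family of `*`-homomorphisms induces a `*`-homomorphism `∏ X_λ / ⨁ X_λ → ∏ Y_λ / ⨁ Y_λ`. -/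
def ReducedProduct.map (f : ∀ l, X l →⋆ₐ[ℂ] Y l) : ReducedProduct X →⋆ₐ[ℂ] ReducedProduct Y :=
  StarQuotient.lift _ ((StarQuotient.mk _).comp (piMap f)) fun x hx =>
    (StarQuotient.mk_eq_zero_iff _).2 <| by
      rw [mem_directSumIdeal] at hx ⊢
      exact hx.subset fun l hl h => hl (by simp [piMap, h])

theorem ReducedProduct.map_mk (f : ∀ l, X l →⋆ₐ[ℂ] Y l) (x : ∀ l, X l) :
    ReducedProduct.map f (StarQuotient.mk _ x) = StarQuotient.mk _ fun l => f l (x l) := rfl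

end ReducedProduct

/-! ### The category of `*`-algebras -/

/-- The category of unital `*`-algebras over `ℂ` and unital `*`-homomorphisms. -/
structure StarAlgCat where
  carrier : Type u
  [instRing : Ring carrier]
  [instStarRing : StarRing carrier]
  [instAlgebra : Algebra ℂ carrier]
  [instStarModule : StarModule ℂ carrier]

attribute [instance] StarAlgCat.instRing StarAlgCat.instStarRing
  StarAlgCat.instAlgebra StarAlgCat.instStarModule

instance : Category StarAlgCat.{u} where
  Hom X Y := X.carrier →⋆ₐ[ℂ] Y.carrier
  id X := StarAlgHom.id ℂ X.carrier
  comp f g := g.comp f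

/-- A `*`-homomorphism, as a morphism of the category. -/
def StarAlgCat.ofHom {X Y : StarAlgCat.{u}} (f : X.carrier →⋆ₐ[ℂ] Y.carrier) : X ⟶ Y := f

/-! ### Asymptotic compactified algebras -/

namespace CovariantQuasiLocalAlgebra

variable {L : Type u} [MetricSpace L] {G₀ : Subgroup (L ≃ᵢ L)}
  {Λ : Type v} (G : Λ → Subgroup G₀)

/-- The asymptotic `(D, T)`-compactified algebra
`∏_λ Cpt_{D,T}^{G_λ}(A, δ) / ⨁_λ Cpt_{D,T}^{G_λ}(A, δ)`. -/
abbrev AsymptoticCpt (A : CovariantQuasiLocalAlgebra.{u, w} G₀) (p : A.Param) :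
    Type (max u v w) :=
  ReducedProduct fun l => A.Cpt (G l) p

variable [BoundedGeometry L] {A B : CovariantQuasiLocalAlgebra.{u, w} G₀}

/-- The canonical `*`-homomorphism between the asymptotic compactified algebras of `A` for
parameters `p ≤ q`. It sends the class of a letter `a ∈ A_V` to the class of the letter
`a ∈ A_V` in each component. -/
def asymptoticTransition {p q : A.Param} (h : p ≤ q) :
    AsymptoticCpt G A p →⋆ₐ[ℂ] AsymptoticCpt G A q :=
  ReducedProduct.map fun l => cptMap (G l) (𝟙 A) (Enlargement.refl L) (fun _ _ ha => ha) p q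
    h.1 (by simpa using h.2.1) (by simpa using h.2.2)

/-- The `*`-homomorphism between the asymptotic compactified algebras induced by a homomorphism `α`
of spread at most `s`. It sends the class of a letter `a ∈ A_V` to the class of the letter
`α a ∈ B_{V⁺ˢ}` in each component. -/
def asymptoticMap (α : A ⟶ B) {s : ℝ≥0} (hs : HasSpread α.toHom s) (p : A.Param) (q : B.Param)
    (hδ : p.δ ≤ q.δ) (hD : p.D + 2 * s ≤ q.D) (hT : p.T + 2 * s ≤ q.T) :
    AsymptoticCpt G A p →⋆ₐ[ℂ] AsymptoticCpt G B q :=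
  ReducedProduct.map fun l => cptMap (G l) α (Enlargement.nbhd L s) hs.mem p q hδ hD hT

/-- The class in the asymptotic compactified algebra of a family of elements of the free product
over `𝔉_D(L)`. -/
def asymptoticMk (p : A.Param) (x : Λ → A.LocalProduct p.D (Set.univ : Set L)) :
    AsymptoticCpt G A p :=
  StarQuotient.mk _ fun l => StarQuotient.mk (A.contractedIdeal (G l) p) (x l)

theorem asymptoticMk_surjective (p : A.Param) :
    Function.Surjective (asymptoticMk (A := A) G p) := by
  intro y
  obtain ⟨y, rfl⟩ := StarQuotient.mk_surjective _ y
  choose x hx using fun l => StarQuotient.mk_surjective _ (y l)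
  exact ⟨x, congrArg (StarQuotient.mk _) (funext hx)⟩

theorem asymptoticTransition_mk {p q : A.Param} (h : p ≤ q)
    (x : Λ → A.LocalProduct p.D (Set.univ : Set L)) :
    asymptoticTransition G h (asymptoticMk G p x)
      = asymptoticMk G q fun l => localMap (StarAlgHom.id ℂ A.carrier) (Enlargement.refl L)
          (fun _ _ ha => ha) (by simpa using h.2.1) (x l) := rfl

/-- The diagram of the asymptotic compactified algebras of `A`, indexed by the parameters. -/
def asymptoticDiagram (A : CovariantQuasiLocalAlgebra.{u, w} G₀) :
    A.Param ⥤ StarAlgCat.{max u v w} where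
  obj p := { carrier := AsymptoticCpt G A p }
  map f := StarAlgCat.ofHom (asymptoticTransition G (leOfHom f))
  map_id p := StarAlgHom.ext fun y => by
    obtain ⟨x, rfl⟩ := asymptoticMk_surjective G p y
    refine (asymptoticTransition_mk G _ x).trans (congrArg _ (funext fun l => ?_))
    exact NetProduct.map_id _ _ (fun _ => rfl) _
  map_comp {p q r} f g := StarAlgHom.ext fun y => by
    obtain ⟨x, rfl⟩ := asymptoticMk_surjective G p y
    refine (asymptoticTransition_mk G _ x).trans (Eq.symm ?_)
    refine (congrArg (asymptoticTransition G (leOfHom g))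
      (asymptoticTransition_mk G (leOfHom f) x)).trans ?_
    refine (asymptoticTransition_mk G _ _).trans (congrArg _ (funext fun l => ?_))
    exact NetProduct.map_map _ _ _ _ _ _ _ _ _ (fun _ => rfl) (fun _ => rfl) _

/-- The property of being locally presented, which defines a full subcategory. -/
def locallyPresented (G₀ : Subgroup (L ≃ᵢ L)) :
    ObjectProperty (CovariantQuasiLocalAlgebra.{u, w} G₀) :=
  fun A => A.IsLocallyPresented

end CovariantQuasiLocalAlgebra

end

noncomputable section

set_option linter.unusedSectionVars false

/-! ### Relations between words and letters -/

/-! The relations of a compactified algebra involve only pairs of regions that are `δ`-close, pairs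
whose orbits are far apart, and translates. If `G` acts freely at a large scale, they nevertheless
imply every relation that `A` has between two regions inside a bounded set
(`pairIncl_mem_cptIdeal`): when `d(V, W) > δ`, no nontrivial `g` can bring `W` to within `δ` of `V`,
so the orbits are far apart as well, and the commutators, which generate the kernel by local
commutativity, are imposed. Hence the local presentation of `A` can be used in bounded parts of the
compactification.

Admissible parameters can be raised because a letter over a larger region is, modulo relations
between pairs, a word over smaller regions. Rewriting a long word letter by letter reduces its
relations to those already known (`LocallyPresented.enlarge`).

The same rewriting, carried out in the compactified algebra, makes the transition maps surjective.
For equal `T` the relations for both parameters live in one free product, where raising `δ` adds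
nothing new, so the transition maps are injective. Both statements need freeness only at a scale
determined by the two parameters, so they hold for all but finitely many members of the family, and
the product modulo the direct sum does not see the others.

For functoriality, the colimit is the free product modulo the identifications of the diagram.
Iterated neighbourhoods satisfy only `(U⁺ˢ)⁺ᵗ ⊆ U⁺⁽ˢ⁺ᵗ⁾`, so the induced maps are studied for
arbitrary enlargements of regions. The choice is immaterial (`cptMap_eq_of_enlargement`), since one
element placed in two regions with a common point gives letters that differ by a local relation.
Directedness of the parameters then makes the maps into the colimit independent of all choices
(`asymptoticHom_comp_ι`), and functoriality and compatibility follow from `ι_asymptoticColimitMap`.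
-/

/-- Congruence modulo a two-sided ideal respects sums and products, so a word can be replaced by
replacing its letters one at a time. This is the rewriting device both for enlarging a presentation
and for surjectivity of the transition maps. -/
theorem NetProduct.exists_sub_mem {L : Type u} {A : Type v} [Ring A] [StarRing A] [Algebra ℂ A]
    [StarModule ℂ A] {ι : Type w} {N : Set L → StarSubalgebra ℂ A} {R : ι → Set L}
    {B C : Type*} [Ring B] [StarRing B] [Algebra ℂ B] [Ring C] [StarRing C] [Algebra ℂ C]
    (f : NetProduct N R →⋆ₐ[ℂ] C) (g : B →⋆ₐ[ℂ] C) (I : TwoSidedIdeal C)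
    (h : ∀ i a ha, ∃ y, f (NetProduct.letter N R i a ha) - g y ∈ I) (x : NetProduct N R) :
    ∃ y, f x - g y ∈ I := by
  induction x using StarFreeProduct.induction with
  | hι i a => exact h i a.1 a.2
  | hc r =>
    refine ⟨algebraMap ℂ B r, ?_⟩
    rw [AlgHomClass.commutes, AlgHomClass.commutes, sub_self]
    exact zero_mem I
  | hadd x y hx hy =>
    obtain ⟨x', hx⟩ := hx
    obtain ⟨y', hy⟩ := hy
    refine ⟨x' + y', ?_⟩
    rw [map_add, map_add, add_sub_add_comm]
    exact add_mem hx hy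
  | hmul x y hx hy =>
    obtain ⟨x', hx⟩ := hx
    obtain ⟨y', hy⟩ := hy
    refine ⟨x' * y', ?_⟩
    have h1 : f (x * y) - g (x' * y') = f x * (f y - g y') + (f x - g x') * g y' := by
      rw [map_mul, map_mul]
      noncomm_ring
    rw [h1]
    exact add_mem (I.mul_mem_left _ _ hy) (I.mul_mem_right _ _ hx)

theorem nbhd_nbhd_subset {L : Type u} [MetricSpace L] {s t c : ℝ≥0} (h : s + t ≤ c) (U : Set L) :
    nbhd s (nbhd t U) ⊆ nbhd c U :=
  (Metric.cthickening_cthickening_subset s.2 t.2 U).trans (nbhd_mono h U)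

theorem subset_nbhd {L : Type u} [MetricSpace L] (s : ℝ≥0) (U : Set L) : U ⊆ nbhd s U :=
  Metric.self_subset_cthickening U

theorem ediam_nbhd_le {L : Type u} [MetricSpace L] {s D c : ℝ≥0} {U : Set L}
    (hU : Metric.ediam U ≤ D) (h : D + 2 * s ≤ c) : Metric.ediam (nbhd s U) ≤ c := by
  have h1 : ((D + 2 * s : ℝ≥0) : ℝ≥0∞) ≤ c := ENNReal.coe_le_coe.2 h
  push_cast at h1
  exact (Metric.ediam_cthickening_le s).trans ((add_le_add_left hU _).trans h1)

theorem LocallyCommutative.mono {L : Type u} [MetricSpace L] {A : Type v} [Ring A] [StarRing A]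
    [Algebra ℂ A] [StarModule ℂ A] {N : Set L → StarSubalgebra ℂ A} {δ δ₁ : ℝ≥0}
    (h : LocallyCommutative N δ) (hδ : δ ≤ δ₁) : LocallyCommutative N δ₁ :=
  fun U V hUV => h U V ((ENNReal.coe_le_coe.2 hδ).trans_lt hUV)

/-! ### Words, pair relations and the enlargement of presentation parameters. -/

namespace QuasiLocalAlgebra

variable {L : Type u} [MetricSpace L] (A : QuasiLocalAlgebra.{u, w} L)

theorem eval_incl {D D₁ : ℝ≥0} {U U₁ : Set L} (hD : D ≤ D₁) (hU : U ⊆ U₁)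
    (x : A.LocalProduct D U) : A.eval D₁ U₁ (A.incl hD hU x) = A.eval D U x :=
  NetProduct.eval_map _ _ _ _

theorem incl_incl {D D₁ D₂ : ℝ≥0} {U U₁ U₂ : Set L} (hD : D ≤ D₁) (hU : U ⊆ U₁) (hD₁ : D₁ ≤ D₂)
    (hU₁ : U₁ ⊆ U₂) (x : A.LocalProduct D U) :
    A.incl hD₁ hU₁ (A.incl hD hU x) = A.incl (hD.trans hD₁) (hU.trans hU₁) x :=
  NetProduct.map_map _ _ _ _ _ _ _ _ _ (fun _ => rfl) (fun _ => rfl) _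

theorem incl_letter {D D₁ : ℝ≥0} {U U₁ : Set L} (hD : D ≤ D₁) (hU : U ⊆ U₁) (V : Region D U)
    (a : A.carrier) (ha : a ∈ A.net V.1) :
    A.incl hD hU (NetProduct.letter A.net (fun V : Region D U => V.1) V a ha)
      = NetProduct.letter A.net (fun V : Region D₁ U₁ => V.1) (V.incl hD hU) a ha :=
  NetProduct.map_letter _ _ _ _ _ _

theorem incl_pairIncl {D D₁ : ℝ≥0} {U U₁ : Set L} (hD : D ≤ D₁) (hU : U ⊆ U₁) (V W : Region D U)
    (x : PairProduct A.net V.1 W.1) :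
    A.incl hD hU (A.pairIncl V W x) = A.pairIncl (V.incl hD hU) (W.incl hD hU) x := by
  have key : (A.incl hD hU).comp (A.pairIncl V W)
      = A.pairIncl (V.incl hD hU) (W.incl hD hU) := by
    refine NetProduct.hom_ext fun b a ha => ?_
    rw [StarAlgHom.comp_apply]
    refine (congrArg _ (NetProduct.map_letter _ _ _ _ _ _)).trans ?_
    refine (NetProduct.map_letter _ _ _ _ _ _).trans ?_
    refine Eq.trans ?_ (NetProduct.map_letter _ _ _ _ _ _).symm
    exact NetProduct.letter_congr (by cases b <;> rfl) rfl _ _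
  exact DFunLike.congr_fun key x

/-- The preimage of `I` under the inclusion is an ideal, so only the generators need to be checked.
With `I` left arbitrary, this transports a presentation both to larger parameters and into the ideal
of a compactified algebra. -/
theorem incl_mem_of_mem_pairIdeal {D D₁ : ℝ≥0} {U U₁ : Set L} (hD : D ≤ D₁) (hU : U ⊆ U₁)
    {P : Region D U → Region D U → Prop} {I : TwoSidedIdeal (A.LocalProduct D₁ U₁)}
    (h : ∀ V W, P V W → ∀ x : PairProduct A.net V.1 W.1,
      NetProduct.eval A.net (fun b : Bool => cond b V.1 W.1) x = 0 →
        A.pairIncl (V.incl hD hU) (W.incl hD hU) x ∈ I)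
    {x : A.LocalProduct D U} (hx : x ∈ A.pairIdeal P) : A.incl hD hU x ∈ I := by
  rw [← TwoSidedIdeal.mem_comap (A.incl hD hU)]
  refine (TwoSidedIdeal.span_le.2 ?_ : A.pairIdeal P ≤ I.comap (A.incl hD hU)) hx
  rintro _ ⟨V, W, hVW, x, hx, rfl⟩
  refine (TwoSidedIdeal.mem_comap (A.incl hD hU)).2 ?_
  rw [incl_pairIncl]
  exact h V W hVW x hx

theorem pairIncl_letter_true {D : ℝ≥0} {U : Set L} (V W : Region D U) (a : A.carrier)
    (ha : a ∈ A.net V.1) :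
    A.pairIncl V W (NetProduct.letter A.net (fun b : Bool => cond b V.1 W.1) true a ha)
      = NetProduct.letter A.net (fun V : Region D U => V.1) V a ha :=
  NetProduct.map_letter _ _ _ _ _ _

theorem pairIncl_letter_false {D : ℝ≥0} {U : Set L} (V W : Region D U) (a : A.carrier)
    (ha : a ∈ A.net W.1) :
    A.pairIncl V W (NetProduct.letter A.net (fun b : Bool => cond b V.1 W.1) false a ha)
      = NetProduct.letter A.net (fun V : Region D U => V.1) W a ha :=
  NetProduct.map_letter _ _ _ _ _ _

theorem pairIncl_mem_pairIdeal {D : ℝ≥0} {U : Set L} {P : Region D U → Region D U → Prop}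
    {V W : Region D U} (h : P V W) {x : PairProduct A.net V.1 W.1}
    (hx : NetProduct.eval A.net (fun b : Bool => cond b V.1 W.1) x = 0) :
    A.pairIncl V W x ∈ A.pairIdeal P :=
  TwoSidedIdeal.subset_span ⟨V, W, h, x, hx, rfl⟩

/-- Soundness of the pair relations: evaluation restricted to two factors is evaluation of the pair.
It guarantees that rewriting a word does not change its value. -/
theorem eval_eq_zero_of_mem_pairIdeal {D : ℝ≥0} {U : Set L} {P : Region D U → Region D U → Prop}
    {x : A.LocalProduct D U} (hx : x ∈ A.pairIdeal P) : A.eval D U x = 0 := by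
  have h : A.pairIdeal P ≤ TwoSidedIdeal.ker (A.eval D U) := by
    refine TwoSidedIdeal.span_le.2 ?_
    rintro _ ⟨V, W, -, x, hx, rfl⟩
    refine (TwoSidedIdeal.mem_ker _).2 ?_
    have h1 : A.eval D U (A.pairIncl V W x) = StarAlgHom.id ℂ A.carrier
      (NetProduct.eval A.net (fun b : Bool => cond b V.1 W.1) x) := by
      have key : (A.eval D U).comp (A.pairIncl V W)
          = NetProduct.eval A.net (fun b : Bool => cond b V.1 W.1) := by
        refine NetProduct.hom_ext fun b a ha => ?_
        rw [StarAlgHom.comp_apply, NetProduct.eval_letter]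
        refine (congrArg _ (NetProduct.map_letter _ _ _ _ _ _)).trans ?_
        exact NetProduct.eval_letter _ _ _
      exact DFunLike.congr_fun key x
    rw [h1, hx, map_zero]
  exact (TwoSidedIdeal.mem_ker _).1 (h hx)

/-- Makes the quotient by pair relations a `*`-algebra, so that `*`-homomorphisms into it can be
compared on letters. -/
instance {D : ℝ≥0} {U : Set L} (P : Region D U → Region D U → Prop) :
    (A.pairIdeal P).IsStarClosed :=
  TwoSidedIdeal.isStarClosed_span fun y hy => by
    obtain ⟨V, W, h, x, hx, rfl⟩ := hy
    exact ⟨V, W, h, star x, by rw [map_star, hx, star_zero], (map_star _ x).symm⟩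

/-- The same element of two local algebras, as a letter of either. -/
theorem letter_sub_letter_mem_pairIdeal {D : ℝ≥0} {U : Set L}
    {P : Region D U → Region D U → Prop} {V W : Region D U} (h : P V W) {a : A.carrier}
    (hV : a ∈ A.net V.1) (hW : a ∈ A.net W.1) :
    NetProduct.letter A.net (fun V : Region D U => V.1) V a hV
      - NetProduct.letter A.net (fun V : Region D U => V.1) W a hW ∈ A.pairIdeal P := by
  have h1 := A.pairIncl_mem_pairIdeal h
    (x := NetProduct.letter A.net (fun b : Bool => cond b V.1 W.1) true a hV
      - NetProduct.letter A.net (fun b : Bool => cond b V.1 W.1) false a hW)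
    (by rw [map_sub, NetProduct.eval_letter, NetProduct.eval_letter, sub_self])
  rwa [map_sub, pairIncl_letter_true, pairIncl_letter_false] at h1

/-- A word in the letters of subregions of a region `W` equals, modulo the relations between pairs,
its value as a letter of `W`. -/
theorem incl_sub_letter_mem_pairIdeal {D T : ℝ≥0} {U : Set L} (W : Region T U) (hD : D ≤ T)
    (x : A.LocalProduct D W.1) (hx : A.eval D W.1 x ∈ A.net W.1) :
    A.incl hD W.2 x - NetProduct.letter A.net (fun V : Region T U => V.1) W (A.eval D W.1 x) hx
      ∈ A.pairIdeal (D := T) (U := U) fun _ _ => True := by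
  -- Evaluation with values in `A_W`; every letter lies there because its region is contained in
  -- `W`.
  let ψ : A.LocalProduct D W.1 →⋆ₐ[ℂ] A.net W.1 :=
    StarFreeProduct.lift fun V : Region D W.1 => StarSubalgebra.inclusion (A.net_mono V.2)
  have hψ : ∀ x, (ψ x : A.carrier) = A.eval D W.1 x := fun x => by
    have h1 : (A.net W.1).subtype.comp ψ = A.eval D W.1 := by
      refine NetProduct.hom_ext fun V a ha => ?_
      rw [StarAlgHom.comp_apply, NetProduct.eval_letter]
      exact congrArg _ (StarFreeProduct.lift_of _ _ _)
    exact DFunLike.congr_fun h1 x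
  let I : TwoSidedIdeal (A.LocalProduct T U) := A.pairIdeal fun _ _ => True
  -- Keeping the word and collapsing it to a single letter of `W` are both multiplicative, so modulo
  -- `I` it is enough to compare them on one letter, where a single pair relation applies.
  have key : (StarQuotient.mk I).comp (A.incl hD W.2) = (StarQuotient.mk I).comp
      ((StarFreeProduct.of (fun V : Region T U => A.net V.1) W).comp ψ) := by
    refine NetProduct.hom_ext fun V a ha => ?_
    rw [StarAlgHom.comp_apply, StarAlgHom.comp_apply, StarAlgHom.comp_apply,
      StarQuotient.mk_eq_iff]
    have h1 := A.letter_sub_letter_mem_pairIdeal (D := T) (U := U) (P := fun _ _ => True)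
      (V := V.incl hD W.2) (W := W) trivial ha (A.net_mono V.2 ha)
    convert h1 using 2
    · exact NetProduct.map_letter _ _ _ _ _ _
    · exact congrArg (StarFreeProduct.of (fun V : Region T U => A.net V.1) W)
        (StarFreeProduct.lift_of _ _ _)
  have h2 := (StarQuotient.mk_eq_iff I).1 (DFunLike.congr_fun key x)
  have h3 : (⟨A.eval D W.1 x, hx⟩ : A.net W.1) = ψ x := Subtype.ext (hψ x).symm
  rw [NetProduct.letter, h3]
  exact h2

variable {A}

/-- The parameters of a local presentation can be increased. -/
theorem LocallyPresented.enlarge {D r T t D₁ T₁ : ℝ≥0} (h : A.LocallyPresented D r T t)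
    (hD : D ≤ D₁) (hT : T ≤ T₁) (hDT : D₁ + 2 * r ≤ T₁) :
    A.LocallyPresented D₁ r T₁ (t + r) := by
  obtain ⟨hg, hDT', hrt, hk⟩ := h
  have hD₁ : D₁ ≤ T₁ := le_self_add.trans hDT
  refine ⟨fun U a ha => ?_, hD₁, le_add_self, fun U x hx => ?_⟩
  · obtain ⟨x, rfl⟩ := hg U a ha
    exact ⟨A.incl hD subset_rfl x, A.eval_incl _ _ _⟩
  -- Rewriting letters supported in `U⁺ʳ` spreads them by another `r`. The original presentation is
  -- therefore applied to `U⁺ʳ` in place of `U`, and its relations live in `(U⁺ʳ)⁺ᵗ`; this is the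
  -- origin of `t + r`.
  · have hr2 : nbhd r (nbhd r U) ⊆ nbhd (t + r) U :=
      nbhd_nbhd_subset (add_le_add_left hrt r) U
    have ht2 : nbhd t (nbhd r U) ⊆ nbhd (t + r) U := nbhd_nbhd_subset le_rfl U
    obtain ⟨y, hy⟩ := NetProduct.exists_sub_mem (A.incl hD₁ (nbhd_mono le_add_self U))
      (A.incl (hD.trans hD₁) hr2) (A.pairIdeal (D := T₁) (U := nbhd (t + r) U) fun _ _ => True)
      (fun V a ha => by
        obtain ⟨y, rfl⟩ := hg V.1 a ha
        have hV : nbhd r V.1 ⊆ nbhd r (nbhd r U) := Metric.cthickening_subset_of_subset _ V.2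
        refine ⟨A.incl le_rfl hV y, ?_⟩
        -- The region `V⁺ʳ` carries both the letter and the word that represents it, and the two are
        -- compared through a letter of this region. Its diameter is the reason for the condition
        -- `D₁ + 2 * r ≤ T₁`.
        let W : Region T₁ (nbhd (t + r) U) :=
          ⟨nbhd r V.1, hV.trans hr2, ediam_nbhd_le V.3 hDT⟩
        have hW : A.eval D (nbhd r V.1) y ∈ A.net W.1 := A.net_mono (subset_nbhd r V.1) ha
        have h1 := A.letter_sub_letter_mem_pairIdeal (P := fun _ _ => True)
          (V := V.incl hD₁ (nbhd_mono le_add_self U)) (W := W) trivial ha hW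
        have h2 := A.incl_sub_letter_mem_pairIdeal W (hD.trans hD₁) y hW
        rw [incl_incl]
        have h3 := sub_mem h1 h2
        rwa [sub_sub_sub_cancel_right, ← incl_letter] at h3) x
    -- The rewritten word uses only regions of diameter at most `D` and still evaluates to zero, so
    -- the given presentation applies to it.
    have hy0 : A.eval D _ y = 0 := by
      have h1 := A.eval_eq_zero_of_mem_pairIdeal hy
      rw [map_sub, eval_incl, eval_incl, hx, zero_sub, neg_eq_zero] at h1
      exact h1
    have h1 := A.incl_mem_of_mem_pairIdeal hT ht2
      (I := A.pairIdeal (D := T₁) (U := nbhd (t + r) U) fun _ _ => True)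
      (fun V W _ x hx => A.pairIncl_mem_pairIdeal trivial hx) (hk (nbhd r U) y hy0)
    rw [incl_incl] at h1
    have h2 := add_mem hy h1
    rwa [sub_add_cancel] at h2

theorem IsLocallyPresented.exists_param_ge (h : A.IsLocallyPresented) (c : ℝ≥0) :
    ∃ p : A.Param, c ≤ p.δ ∧ c ≤ p.D ∧ c ≤ p.T := by
  obtain ⟨D, r, T, t, h⟩ := h
  obtain ⟨δ, hδ⟩ := A.local_commutativity
  -- The last entry of the maximum for `T` is the room that `LocallyPresented.enlarge` needs for the
  -- `r`-neighbourhoods of the enlarged regions.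
  refine ⟨⟨max δ c, max D c, max (max T c) (max D c + 2 * r), hδ.mono (le_max_left _ _),
    r, t + r, h.enlarge (le_max_left _ _) ?_ (le_max_right _ _)⟩, le_max_right _ _,
    le_max_right _ _, ?_⟩
  · exact (le_max_left _ _).trans (le_max_left _ _)
  · exact (le_max_right _ _).trans (le_max_left _ _)

end QuasiLocalAlgebra

/-! ### Independence of the parameters `δ` and `D` -/

namespace CovariantQuasiLocalAlgebra

variable {L : Type u} [MetricSpace L] [BoundedGeometry L] {G₀ : Subgroup (L ≃ᵢ L)}
  {A : CovariantQuasiLocalAlgebra.{u, w} G₀}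

/-- If `G` acts freely at a large scale, the relations between two local algebras within a bounded
region are implied by those that define the compactified algebra. -/
theorem pairIncl_mem_cptIdeal {G : Subgroup G₀} {δ S T : ℝ≥0} (hc : LocallyCommutative A.net δ)
    (hG : FreeAtScale G (S + δ)) {V W : Region T (Set.univ : Set L)}
    (hVW : ∀ x ∈ V.1, ∀ y ∈ W.1, edist x y ≤ S) {x : PairProduct A.net V.1 W.1}
    (hx : NetProduct.eval A.net (fun b : Bool => cond b V.1 W.1) x = 0) :
    A.pairIncl V W x ∈ A.cptIdeal G δ T := by
  by_cases hd : setEDist V.1 W.1 ≤ δ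
  · exact locIdeal_le G δ T (pairIncl_mem_locIdeal V W hd x hx)
  -- For a pair further apart than `δ` the kernel is generated by commutators, so only these remain.
  have hx' := (hc V.1 W.1 (not_le.1 hd) x).1 hx
  rw [← TwoSidedIdeal.mem_comap (A.pairIncl V W)]
  refine (TwoSidedIdeal.span_le.2 ?_ : commutatorIdeal A.net V.1 W.1
    ≤ (A.cptIdeal G δ T).comap (A.pairIncl V W)) hx'
  rintro _ ⟨a, b, ha, hb, rfl⟩
  refine (TwoSidedIdeal.mem_comap (A.pairIncl V W)).2 ?_
  rw [map_sub, map_mul, map_mul, pairIncl_true, pairIncl_false]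
  refine letter_commutator_mem_cptIdeal G V W a b ha hb fun g hg hgd => absurd hgd ?_
  obtain ⟨y, hy, _, ⟨z, hz, rfl⟩, hyz⟩ := exists_edist_le_of_setEDist_le V.ediam_le hgd
  -- Some `z` in `W` has `gz` within `δ` of a point of `V`, which is itself within `S` of `z`. So
  -- `{z, gz}` has diameter at most `S + δ`, and freeness at that scale applies. With `g = 1` the
  -- assumed closeness contradicts `d(V, W) > δ`.
  have h1 : g = 1 := by
    refine hG {z, (g : L ≃ᵢ L) z} ?_ g hg ⟨(g : L ≃ᵢ L) z, ⟨z, by simp, rfl⟩, by simp⟩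
    rw [Metric.ediam_pair, ENNReal.coe_add]
    refine (edist_triangle z y _).trans (add_le_add ?_ hyz)
    rw [edist_comm]
    exact hVW y hy z hz
  subst h1
  have h2 : ((1 : G₀) : L ≃ᵢ L) '' W.1 = W.1 := Set.image_id _
  rwa [h2]

theorem incl_mem_cptIdeal_of_mem_pairIdeal {G : Subgroup G₀} {δ S T : ℝ≥0}
    (hc : LocallyCommutative A.net δ) (hG : FreeAtScale G (S + δ)) {U : Set L}
    (hU : Metric.ediam U ≤ S) {P : Region T U → Region T U → Prop} {x : A.LocalProduct T U}
    (hx : x ∈ A.pairIdeal P) : A.incl le_rfl (Set.subset_univ U) x ∈ A.cptIdeal G δ T :=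
  A.incl_mem_of_mem_pairIdeal le_rfl (Set.subset_univ U)
    (fun V W _ _ hx => pairIncl_mem_cptIdeal hc hG
      (fun _ hy _ hz => (Metric.edist_le_ediam_of_mem (V.2 hy) (W.2 hz)).trans hU) hx) hx

/-- Raising `δ` weakens the distant relations and leaves the orbital ones alone. It adds only local
relations for pairs at distance at most `δ₁`; two regions of diameter at most `T` at such a distance
have all their points within `2T + δ₁` of each other, so freeness supplies these relations. -/
theorem cptIdeal_le_of_free {G : Subgroup G₀} {δ δ₁ T : ℝ≥0} (hc : LocallyCommutative A.net δ)
    (hδ : δ ≤ δ₁) (hG : FreeAtScale G (2 * T + δ₁ + δ)) :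
    A.cptIdeal G δ₁ T ≤ A.cptIdeal G δ T := by
  refine sup_le (sup_le ?_ ?_) (orbIdeal_le G δ T)
  · refine TwoSidedIdeal.span_le.2 ?_
    rintro _ ⟨V, W, h, x, hx, rfl⟩
    refine pairIncl_mem_cptIdeal hc hG (fun y hy z hz => ?_) hx
    obtain ⟨y', hy', z', hz', h'⟩ := exists_edist_le_of_setEDist_le V.ediam_le h
    have h1 := (Metric.edist_le_ediam_of_mem hy hy').trans V.3
    have h2 := (Metric.edist_le_ediam_of_mem hz' hz).trans W.3
    refine (edist_triangle4 y y' z' z).trans ((add_le_add (add_le_add h1 h') h2).trans_eq ?_)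
    push_cast
    ring
  · refine (TwoSidedIdeal.span_le.2 ?_ : A.distIdeal G δ₁ T ≤ A.distIdeal G δ T).trans
      (distIdeal_le G δ T)
    rintro _ ⟨V, W, h, a, b, ha, hb, rfl⟩
    exact letter_commutator_mem_distIdeal G V W ((ENNReal.coe_le_coe.2 hδ).trans_lt h) a b ha hb

/-- The map of compactified algebras that includes letters. -/
abbrev cptTransition (G : Subgroup G₀) {p q : A.Param} (h : p ≤ q) : A.Cpt G p →⋆ₐ[ℂ] A.Cpt G q :=
  cptMap G (𝟙 A) (Enlargement.refl L) (fun _ _ ha => ha) p q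
    h.1 (by simpa using h.2.1) (by simpa using h.2.2)

theorem cptTransition_mk (G : Subgroup G₀) {p q : A.Param} (h : p ≤ q)
    (x : A.LocalProduct p.D (Set.univ : Set L)) :
    cptTransition G h (StarQuotient.mk (A.contractedIdeal G p) x)
      = StarQuotient.mk (A.contractedIdeal G q) (A.incl h.2.1 subset_rfl x) := rfl

/-- Local generation at `p` represents a letter by a word over smaller regions near it. The
difference evaluates to zero in a bounded region, so the presentation at `q` expresses it through
pair relations there, and these hold in the compactified algebra by freeness. The scale does not
depend on `G`, and no equality of the `T`s is needed here. -/
theorem exists_cptTransition_surjective {p q : A.Param} (h : p ≤ q) :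
    ∃ S : ℝ≥0, ∀ G : Subgroup G₀, FreeAtScale G S → Function.Surjective (cptTransition G h) := by
  obtain ⟨r, -, hp, -⟩ := p.pres
  obtain ⟨r', t, -, _, hr, hq⟩ := q.pres
  -- The diameter of `(V⁺ʳ)⁺ᵗ` for `diam V ≤ q.D`, where the relations of the presentation live,
  -- plus `q.δ` for `pairIncl_mem_cptIdeal`.
  refine ⟨q.D + 2 * r + 2 * t + q.δ, fun G hG y => ?_⟩
  obtain ⟨y, rfl⟩ := StarQuotient.mk_surjective _ y
  obtain ⟨x, hx⟩ := NetProduct.exists_sub_mem (A.incl q.D_le_T subset_rfl)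
    (A.incl (h.2.1.trans q.D_le_T) (subset_rfl : (Set.univ : Set L) ⊆ Set.univ))
    (A.cptIdeal G q.δ q.T) (fun V a ha => by
      obtain ⟨x, rfl⟩ := hp V.1 a ha
      refine ⟨A.incl le_rfl (Set.subset_univ _) x, ?_⟩
      let U : Set L := nbhd r V.1
      -- The letter minus its representing word, placed over `U⁺ʳ'` because the presentation at `q`
      -- speaks of words there.
      let z : A.LocalProduct q.D (nbhd r' U) := NetProduct.letter A.net
        (fun V : Region q.D (nbhd r' U) => V.1)
        ⟨V.1, (subset_nbhd r V.1).trans (subset_nbhd r' U), V.3⟩ _ ha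
          - A.incl h.2.1 (subset_nbhd r' U) x
      have hz : A.eval q.D (nbhd r' U) z = 0 := by
        rw [map_sub, NetProduct.eval_letter, QuasiLocalAlgebra.eval_incl, sub_self]
      have h1 := incl_mem_cptIdeal_of_mem_pairIdeal q.comm hG
        (ediam_nbhd_le (ediam_nbhd_le V.3 le_rfl) le_rfl) (hq U z hz)
      rw [QuasiLocalAlgebra.incl_incl, map_sub, QuasiLocalAlgebra.incl_incl,
        QuasiLocalAlgebra.incl_letter] at h1
      rwa [QuasiLocalAlgebra.incl_incl, incl_letter]) y
  refine ⟨StarQuotient.mk _ x, ?_⟩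
  rw [cptTransition_mk, StarQuotient.mk_eq_iff, ← neg_sub]
  refine neg_mem ((TwoSidedIdeal.mem_comap (A.incl q.D_le_T subset_rfl)).2 ?_)
  rwa [map_sub, QuasiLocalAlgebra.incl_incl]

/-- With equal `T` the two ideals are contractions from the same free product, so the choice of `D`
imposes no further relations, and the change of `δ` is harmless by `cptIdeal_le_of_free`. -/
theorem exists_cptTransition_injective {p q : A.Param} (h : p ≤ q) (hT : p.T = q.T) :
    ∃ S : ℝ≥0, ∀ G : Subgroup G₀, FreeAtScale G S → Function.Injective (cptTransition G h) := by
  refine ⟨2 * q.T + q.δ + p.δ, fun G hG => (injective_iff_map_eq_zero _).2 fun y hy => ?_⟩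
  obtain ⟨x, rfl⟩ := StarQuotient.mk_surjective _ y
  rw [cptTransition_mk, StarQuotient.mk_eq_zero_iff] at hy
  rw [StarQuotient.mk_eq_zero_iff]
  have h1 := (TwoSidedIdeal.mem_comap (A.incl q.D_le_T subset_rfl)).1 hy
  rw [QuasiLocalAlgebra.incl_incl] at h1
  have h2 := cptIdeal_le_of_free p.comm h.1 hG h1
  refine (TwoSidedIdeal.mem_comap (A.incl p.D_le_T subset_rfl)).2 ?_
  -- The value of `T` occurs in the types of the free products, so the two values are identified by
  -- substitution, after unpacking the parameters.
  obtain ⟨δ₁, D₁, T₁, c₁, p₁⟩ := p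
  obtain ⟨δ₂, D₂, T₂, c₂, p₂⟩ := q
  dsimp only at hT
  subst hT
  exact h2

end CovariantQuasiLocalAlgebra

/-! ### Injectivity and surjectivity modulo direct sums. -/

section ReducedProduct

variable {Λ : Type v} {X Y : Λ → Type w} [∀ l, Ring (X l)] [∀ l, StarRing (X l)]
  [∀ l, Algebra ℂ (X l)] [∀ l, StarModule ℂ (X l)] [∀ l, Ring (Y l)] [∀ l, StarRing (Y l)]
  [∀ l, Algebra ℂ (Y l)] [∀ l, StarModule ℂ (Y l)]

/-- Preimages are chosen wherever they are certain to exist, and `0` is taken elsewhere. The error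
has finite support and hence lies in the direct sum. -/
theorem ReducedProduct.map_surjective (f : ∀ l, X l →⋆ₐ[ℂ] Y l)
    (h : {l | ¬ Function.Surjective (f l)}.Finite) :
    Function.Surjective (ReducedProduct.map f) := by
  classical
  intro y
  obtain ⟨y, rfl⟩ := StarQuotient.mk_surjective _ y
  refine ⟨StarQuotient.mk _ fun l =>
    if hl : Function.Surjective (f l) then (hl (y l)).choose else 0, ?_⟩
  rw [ReducedProduct.map_mk, StarQuotient.mk_eq_iff, mem_directSumIdeal]
  refine h.subset fun l hl hs => hl ?_
  simp only [Pi.sub_apply, dif_pos hs, (hs (y l)).choose_spec, sub_self]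

/-- A component can be nonzero only where its image is nonzero or where `f l` is not injective, and
both sets of indices are finite. -/
theorem ReducedProduct.map_injective (f : ∀ l, X l →⋆ₐ[ℂ] Y l)
    (h : {l | ¬ Function.Injective (f l)}.Finite) :
    Function.Injective (ReducedProduct.map f) := by
  refine (injective_iff_map_eq_zero _).2 fun x hx => ?_
  obtain ⟨x, rfl⟩ := StarQuotient.mk_surjective _ x
  rw [ReducedProduct.map_mk, StarQuotient.mk_eq_zero_iff, mem_directSumIdeal] at hx
  rw [StarQuotient.mk_eq_zero_iff, mem_directSumIdeal]
  refine (hx.union h).subset fun l hl => ?_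
  by_contra hc
  simp only [Set.mem_union, Set.mem_ofPred_eq, not_or, not_not] at hc
  exact hl ((injective_iff_map_eq_zero (f l)).1 hc.2 _ hc.1)

end ReducedProduct

/-- The scales that ensure injectivity and surjectivity are uniform in the group, so asymptotic
freeness leaves only finitely many exceptional indices. -/
theorem CovariantQuasiLocalAlgebra.asymptoticTransition_bijective {L : Type u} [MetricSpace L]
    [BoundedGeometry L] {G₀ : Subgroup (L ≃ᵢ L)} {Λ : Type v} {G : Λ → Subgroup G₀}
    (hG : AsymptoticallyFree G) {A : CovariantQuasiLocalAlgebra.{u, w} G₀} {p q : A.Param}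
    (h : p ≤ q) (hT : p.T = q.T) : Function.Bijective (asymptoticTransition G h) := by
  obtain ⟨S, hS⟩ := exists_cptTransition_injective h hT
  obtain ⟨S', hS'⟩ := exists_cptTransition_surjective h
  exact ⟨ReducedProduct.map_injective _ ((hG.2 S).subset fun l hl hf => hl (hS _ hf)),
    ReducedProduct.map_surjective _ ((hG.2 S').subset fun l hl hf => hl (hS' _ hf))⟩

/-! ### Colimits of `*`-algebras -/

namespace StarAlgCat

variable {J : Type v} [Category J] (F : J ⥤ StarAlgCat.{max v w})

/-- The `*`-homomorphism underlying a morphism. -/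
def toHom {X Y : StarAlgCat.{u}} (f : X ⟶ Y) : X.carrier →⋆ₐ[ℂ] Y.carrier := f

theorem toHom_comp_apply {X Y Z : StarAlgCat.{u}} (f : X ⟶ Y) (g : Y ⟶ Z) (a : X.carrier) :
    toHom (f ≫ g) a = toHom g (toHom f a) := rfl

theorem hom_ext {X Y : StarAlgCat.{u}} {f g : X ⟶ Y} (h : ∀ a, toHom f a = toHom g a) : f = g :=
  StarAlgHom.ext h

/-- The inclusion of a value of a diagram into the free product of all of them. -/
abbrev colimitLetter (j : J) :
    (F.obj j).carrier →⋆ₐ[ℂ] StarFreeProduct fun j => (F.obj j).carrier :=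
  StarFreeProduct.of (fun j => (F.obj j).carrier) j

/-- The relations of the colimit, in the free product of the values of a diagram. -/
def colimitIdeal : TwoSidedIdeal (StarFreeProduct fun j => (F.obj j).carrier) :=
  TwoSidedIdeal.span {y | ∃ (i j : J) (f : i ⟶ j) (a : (F.obj i).carrier),
    y = colimitLetter F i a - colimitLetter F j (toHom (F.map f) a)}

instance : (colimitIdeal F).IsStarClosed :=
  TwoSidedIdeal.isStarClosed_span fun y hy => by
    obtain ⟨i, j, f, a, rfl⟩ := hy
    exact ⟨i, j, f, star a, by rw [star_sub, ← map_star, ← map_star, ← map_star]⟩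

/-- The colimit of a diagram of `*`-algebras, as a quotient of the free product. -/
def colimitObj : StarAlgCat.{max v w} := { carrier := StarQuotient (colimitIdeal F) }

/-- The canonical map of a value of a diagram into the colimit. -/
def colimitι (j : J) : F.obj j ⟶ colimitObj F :=
  ofHom (X := F.obj j) (Y := colimitObj F)
    ((StarQuotient.mk (colimitIdeal F)).comp (colimitLetter F j))

/-- The colimit of a diagram of `*`-algebras, with its canonical maps. -/
def colimitCocone : Limits.Cocone F where
  pt := colimitObj F
  ι :=
    { app := colimitι F
      naturality := fun i j f => hom_ext fun a =>
        ((StarQuotient.mk_eq_iff (colimitIdeal F)).2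
          (TwoSidedIdeal.subset_span ⟨i, j, f, a, rfl⟩)).symm }

variable {F} (s : Limits.Cocone F)

/-- The map of the free product of the values of a diagram to the point of a cocone. -/
def freeDesc : (StarFreeProduct fun j => (F.obj j).carrier) →⋆ₐ[ℂ] s.pt.carrier :=
  StarFreeProduct.lift fun j => toHom (s.ι.app j)

theorem freeDesc_letter (j : J) (a : (F.obj j).carrier) :
    freeDesc s (colimitLetter F j a) = toHom (s.ι.app j) a :=
  StarFreeProduct.lift_of (fun j => toHom (s.ι.app j)) j a

theorem freeDesc_eq_zero {x : StarFreeProduct fun j => (F.obj j).carrier}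
    (hx : x ∈ colimitIdeal F) : freeDesc s x = 0 := by
  have h : colimitIdeal F ≤ TwoSidedIdeal.ker (freeDesc s) := by
    refine TwoSidedIdeal.span_le.2 ?_
    rintro _ ⟨i, j, f, a, rfl⟩
    refine (TwoSidedIdeal.mem_ker _).2 ?_
    rw [map_sub, freeDesc_letter, freeDesc_letter, sub_eq_zero, ← toHom_comp_apply, s.w]
  exact (TwoSidedIdeal.mem_ker _).1 (h hx)

/-- The map of the colimit to the point of a cocone. -/
def colimitDesc : StarQuotient (colimitIdeal F) →⋆ₐ[ℂ] s.pt.carrier :=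
  StarQuotient.lift (colimitIdeal F) (freeDesc s) fun _ hx => freeDesc_eq_zero s hx

theorem eq_colimitDesc (m : StarQuotient (colimitIdeal F) →⋆ₐ[ℂ] s.pt.carrier)
    (hm : ∀ j a, m (StarQuotient.mk (colimitIdeal F) (colimitLetter F j a))
      = toHom (s.ι.app j) a) : m = colimitDesc s := by
  have key : m.comp (StarQuotient.mk (colimitIdeal F)) = freeDesc s :=
    StarFreeProduct.hom_ext fun j a => (hm j a).trans (freeDesc_letter s j a).symm
  exact StarQuotient.hom_ext fun x => DFunLike.congr_fun key x

variable (F) in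
/-- The universal property of the colimit. -/
def colimitCoconeIsColimit : Limits.IsColimit (colimitCocone F) where
  desc s := ofHom (X := colimitObj F) (Y := s.pt) (colimitDesc s)
  fac s j := hom_ext fun a => freeDesc_letter s j a
  uniq s m hm := eq_colimitDesc s (toHom m) fun j a =>
    congrArg (fun f : F.obj j ⟶ s.pt => toHom f a) (hm j)

end StarAlgCat

/-! ### Functoriality -/

/-- The composition of two enlargements. -/
abbrev Enlargement.comp {L : Type u} [MetricSpace L] {s t : ℝ≥0} (e : Enlargement L s)
    (e' : Enlargement L t) : Enlargement L (s + t) where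
  toFun U := e'.toFun (e.toFun U)
  subset U := (e.subset U).trans (e'.subset _)
  ediam_le U := (e'.ediam_le _).trans <| (add_le_add_left (e.ediam_le U) _).trans_eq <| by
    push_cast
    ring
  image g U := by rw [e.image, e'.image]

/-- The empty region has to be tracked separately: its distance to any set is infinite, so no local
relation compares its letters with others. -/
theorem Enlargement.nbhd_empty (L : Type u) [MetricSpace L] (s : ℝ≥0) :
    (Enlargement.nbhd L s).toFun ∅ = ∅ :=
  Metric.cthickening_empty _

namespace CovariantQuasiLocalAlgebra

variable {L : Type u} [MetricSpace L] [BoundedGeometry L] {G₀ : Subgroup (L ≃ᵢ L)}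
  {A B C : CovariantQuasiLocalAlgebra.{u, w} G₀}

theorem cptMap_mk (G : Subgroup G₀) (α : A ⟶ B) {s : ℝ≥0} (e : Enlargement L s)
    (he : ∀ U, ∀ a ∈ A.net U, α.toHom a ∈ B.net (e.toFun U)) (p : A.Param) (q : B.Param)
    (hδ : p.δ ≤ q.δ) (hD : p.D + 2 * s ≤ q.D) (hT : p.T + 2 * s ≤ q.T)
    (x : A.LocalProduct p.D (Set.univ : Set L)) :
    cptMap G α e he p q hδ hD hT (StarQuotient.mk _ x)
      = StarQuotient.mk _ (localMap α.toHom e he hD x) := rfl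

/-- The induced map does not depend on the choice of the enlargement. -/
theorem cptMap_eq_of_enlargement (G : Subgroup G₀) (α : A ⟶ B) {s s' : ℝ≥0} (e : Enlargement L s)
    (e' : Enlargement L s') (hee : e.toFun ∅ = e'.toFun ∅)
    (he : ∀ U, ∀ a ∈ A.net U, α.toHom a ∈ B.net (e.toFun U))
    (he' : ∀ U, ∀ a ∈ A.net U, α.toHom a ∈ B.net (e'.toFun U)) (p : A.Param) (q : B.Param)
    (hδ : p.δ ≤ q.δ) (hD : p.D + 2 * s ≤ q.D) (hT : p.T + 2 * s ≤ q.T)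
    (hD' : p.D + 2 * s' ≤ q.D) (hT' : p.T + 2 * s' ≤ q.T) :
    cptMap G α e he p q hδ hD hT = cptMap G α e' he' p q hδ hD' hT' := by
  have key : (StarQuotient.mk (B.contractedIdeal G q)).comp (localMap α.toHom e he hD)
      = (StarQuotient.mk (B.contractedIdeal G q)).comp (localMap α.toHom e' he' hD') := by
    refine NetProduct.hom_ext fun V a ha => ?_
    rw [StarAlgHom.comp_apply, StarAlgHom.comp_apply, localMap_letter, localMap_letter]
    -- A point of `V` lies in both enlargements, so their distance is `0` and a local relation
    -- identifies the two letters. For empty `V` there is no such point, and the two regions must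
    -- coincide outright.
    rcases V.1.eq_empty_or_nonempty with h | ⟨x, hx⟩
    · refine congrArg _ (NetProduct.letter_congr (Region.ext ?_) rfl _ _)
      change e.toFun V.1 = e'.toFun V.1
      rw [h, hee]
    · rw [StarQuotient.mk_eq_iff]
      refine (TwoSidedIdeal.mem_comap (B.incl q.D_le_T subset_rfl)).2 ?_
      rw [map_sub, incl_letter, incl_letter]
      refine locIdeal_le G _ _ (B.letter_sub_letter_mem_pairIdeal ?_ _ _)
      refine (setEDist_le (e.subset _ hx) (e'.subset _ hx)).trans ?_
      rw [edist_self]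
      exact zero_le
  exact StarQuotient.hom_ext fun x => DFunLike.congr_fun key x

theorem comp_mem_net {α : A ⟶ B} {β : B ⟶ C} {s t : ℝ≥0} {e : Enlargement L s}
    {e' : Enlargement L t} (he : ∀ U, ∀ a ∈ A.net U, α.toHom a ∈ B.net (e.toFun U))
    (he' : ∀ U, ∀ b ∈ B.net U, β.toHom b ∈ C.net (e'.toFun U)) (U : Set L) (a : A.carrier)
    (ha : a ∈ A.net U) : (α ≫ β).toHom a ∈ C.net ((e.comp e').toFun U) :=
  he' _ _ (he U a ha)

theorem add_two_mul_le {x y z s t : ℝ≥0} (h : x + 2 * s ≤ y) (h' : y + 2 * t ≤ z) :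
    x + 2 * (s + t) ≤ z := by
  rw [mul_add, ← add_assoc]
  exact (add_le_add_left h _).trans h'

/-- Composition is exact already on letters because the composite enlargement is used, rather than
the neighbourhood of radius `s + t`. -/
theorem cptMap_cptMap (G : Subgroup G₀) (α : A ⟶ B) (β : B ⟶ C) {s t : ℝ≥0}
    (e : Enlargement L s) (e' : Enlargement L t)
    (he : ∀ U, ∀ a ∈ A.net U, α.toHom a ∈ B.net (e.toFun U))
    (he' : ∀ U, ∀ b ∈ B.net U, β.toHom b ∈ C.net (e'.toFun U))
    (p : A.Param) (q : B.Param) (r : C.Param)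
    (hδ : p.δ ≤ q.δ) (hD : p.D + 2 * s ≤ q.D) (hT : p.T + 2 * s ≤ q.T)
    (hδ' : q.δ ≤ r.δ) (hD' : q.D + 2 * t ≤ r.D) (hT' : q.T + 2 * t ≤ r.T) (x : A.Cpt G p) :
    cptMap G β e' he' q r hδ' hD' hT' (cptMap G α e he p q hδ hD hT x)
      = cptMap G (α ≫ β) (e.comp e') (comp_mem_net he he') p r (hδ.trans hδ')
        (add_two_mul_le hD hD') (add_two_mul_le hT hT') x := by
  obtain ⟨x, rfl⟩ := StarQuotient.mk_surjective _ x
  rw [cptMap_mk, cptMap_mk, cptMap_mk]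
  exact congrArg _ (NetProduct.map_map _ _ _ _ _ _ _ _ _ (fun _ => rfl) (fun _ => rfl) _)

/-! ### Induced maps of the asymptotic compactified algebras. -/

variable {Λ : Type v} (G : Λ → Subgroup G₀)

/-- The morphism of asymptotic compactified algebras induced by `α` and an enlargement. -/
def asymptoticHom (α : A ⟶ B) {s : ℝ≥0} (e : Enlargement L s)
    (he : ∀ U, ∀ a ∈ A.net U, α.toHom a ∈ B.net (e.toFun U)) (p : A.Param) (q : B.Param)
    (hδ : p.δ ≤ q.δ) (hD : p.D + 2 * s ≤ q.D) (hT : p.T + 2 * s ≤ q.T) :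
    (asymptoticDiagram G A).obj p ⟶ (asymptoticDiagram G B).obj q :=
  StarAlgCat.ofHom (X := (asymptoticDiagram G A).obj p) (Y := (asymptoticDiagram G B).obj q)
    (ReducedProduct.map fun l => cptMap (G l) α e he p q hδ hD hT)

theorem id_mem_net (U : Set L) (a : A.carrier) (ha : a ∈ A.net U) :
    (𝟙 A : A ⟶ A).toHom a ∈ A.net ((Enlargement.refl L).toFun U) := ha

theorem asymptoticDiagram_map {p q : A.Param} (f : p ⟶ q) :
    (asymptoticDiagram G A).map f = asymptoticHom G (𝟙 A) (Enlargement.refl L)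
      id_mem_net p q (leOfHom f).1 (by simpa using (leOfHom f).2.1)
      (by simpa using (leOfHom f).2.2) := rfl

/-- The two morphisms are allowed to differ syntactically, so that composites with identities can be
absorbed. -/
theorem asymptoticHom_eq_of_enlargement {α α' : A ⟶ B} (hα : α = α') {s s' : ℝ≥0}
    (e : Enlargement L s) (e' : Enlargement L s') (hee : e.toFun ∅ = e'.toFun ∅)
    (he : ∀ U, ∀ a ∈ A.net U, α.toHom a ∈ B.net (e.toFun U))
    (he' : ∀ U, ∀ a ∈ A.net U, α'.toHom a ∈ B.net (e'.toFun U)) (p : A.Param) (q : B.Param)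
    (hδ : p.δ ≤ q.δ) (hD : p.D + 2 * s ≤ q.D) (hT : p.T + 2 * s ≤ q.T)
    (hD' : p.D + 2 * s' ≤ q.D) (hT' : p.T + 2 * s' ≤ q.T) :
    asymptoticHom G α e he p q hδ hD hT = asymptoticHom G α' e' he' p q hδ hD' hT' := by
  subst hα
  have h : (fun l => cptMap (G l) α e he p q hδ hD hT)
      = fun l => cptMap (G l) α e' he' p q hδ hD' hT' :=
    funext fun l => cptMap_eq_of_enlargement (G l) α e e' hee he he' p q hδ hD hT hD' hT'
  rw [asymptoticHom, asymptoticHom, h]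

theorem asymptoticHom_comp (α : A ⟶ B) (β : B ⟶ C) {s t : ℝ≥0}
    (e : Enlargement L s) (e' : Enlargement L t)
    (he : ∀ U, ∀ a ∈ A.net U, α.toHom a ∈ B.net (e.toFun U))
    (he' : ∀ U, ∀ b ∈ B.net U, β.toHom b ∈ C.net (e'.toFun U))
    (p : A.Param) (q : B.Param) (r : C.Param)
    (hδ : p.δ ≤ q.δ) (hD : p.D + 2 * s ≤ q.D) (hT : p.T + 2 * s ≤ q.T)
    (hδ' : q.δ ≤ r.δ) (hD' : q.D + 2 * t ≤ r.D) (hT' : q.T + 2 * t ≤ r.T) :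
    asymptoticHom G α e he p q hδ hD hT ≫ asymptoticHom G β e' he' q r hδ' hD' hT'
      = asymptoticHom G (α ≫ β) (e.comp e') (comp_mem_net he he') p r (hδ.trans hδ')
        (add_two_mul_le hD hD') (add_two_mul_le hT hT') :=
  StarAlgHom.ext fun y => by
    obtain ⟨y, rfl⟩ := StarQuotient.mk_surjective _ y
    exact congrArg (StarQuotient.mk _) (funext fun l => cptMap_cptMap (G l) α β e e' he he' p q r
      hδ hD hT hδ' hD' hT' (y l))

/-! ### Directedness of the parameters and the passage to the colimit. -/

theorem exists_param_ge_param (hA : A.IsLocallyPresented) (p q : A.Param) :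
    ∃ r : A.Param, p ≤ r ∧ q ≤ r := by
  obtain ⟨r, h₁, h₂, h₃⟩ := hA.exists_param_ge
    (max (max p.δ q.δ) (max (max p.D q.D) (max p.T q.T)))
  simp only [max_le_iff] at h₁ h₂ h₃
  exact ⟨r, ⟨h₁.1.1, h₂.2.1.1, h₃.2.2.1⟩, ⟨h₁.1.2, h₂.2.1.2, h₃.2.2.2⟩⟩

theorem exists_param_add_le (hB : B.IsLocallyPresented) (p : A.Param) (s : ℝ≥0) :
    ∃ q : B.Param, p.δ ≤ q.δ ∧ p.D + 2 * s ≤ q.D ∧ p.T + 2 * s ≤ q.T := by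
  obtain ⟨q, h₁, h₂, h₃⟩ := hB.exists_param_ge
    (max p.δ (max (p.D + 2 * s) (p.T + 2 * s)))
  simp only [max_le_iff] at h₁ h₂ h₃
  exact ⟨q, h₁.1, h₂.2.1, h₃.2.2⟩

/-- The map to the colimit induced by `α` depends neither on the enlargement nor on the parameters
of the target. -/
theorem asymptoticHom_comp_ι (hB : B.IsLocallyPresented)
    (c : Limits.Cocone (asymptoticDiagram G B)) {α α' : A ⟶ B} (hα : α = α') {s s' : ℝ≥0}
    (e : Enlargement L s) (e' : Enlargement L s') (hee : e.toFun ∅ = e'.toFun ∅)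
    (he : ∀ U, ∀ a ∈ A.net U, α.toHom a ∈ B.net (e.toFun U))
    (he' : ∀ U, ∀ a ∈ A.net U, α'.toHom a ∈ B.net (e'.toFun U)) (p : A.Param) (q q' : B.Param)
    (hδ : p.δ ≤ q.δ) (hD : p.D + 2 * s ≤ q.D) (hT : p.T + 2 * s ≤ q.T)
    (hδ' : p.δ ≤ q'.δ) (hD' : p.D + 2 * s' ≤ q'.D) (hT' : p.T + 2 * s' ≤ q'.T) :
    asymptoticHom G α e he p q hδ hD hT ≫ c.ι.app q
      = asymptoticHom G α' e' he' p q' hδ' hD' hT' ≫ c.ι.app q' := by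
  -- Both maps are pushed to a common larger parameter of the target. There they differ only in
  -- their enlargements, which does not matter.
  obtain ⟨r, hr, hr'⟩ := exists_param_ge_param hB q q'
  rw [← c.w (homOfLE hr), ← c.w (homOfLE hr'), ← Category.assoc, ← Category.assoc,
    asymptoticDiagram_map, asymptoticDiagram_map, asymptoticHom_comp, asymptoticHom_comp]
  congr 1
  exact asymptoticHom_eq_of_enlargement G (by rw [hα]) (e.comp (Enlargement.refl L))
    (e'.comp (Enlargement.refl L)) hee _ _ _ _ _ _ _ _ _

/-- A transition map is the map induced by the identity with the trivial enlargement. Composing with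
it thus changes only the parameters passed through, and the colimit forgets those. -/
theorem asymptoticDiagram_map_comp_ι (hB : B.IsLocallyPresented)
    (c : Limits.Cocone (asymptoticDiagram G B)) (α : A ⟶ B) {s : ℝ≥0} (e : Enlargement L s)
    (he : ∀ U, ∀ a ∈ A.net U, α.toHom a ∈ B.net (e.toFun U)) {p p' : A.Param} (f : p ⟶ p')
    (q q' : B.Param) (hδ : p.δ ≤ q.δ) (hD : p.D + 2 * s ≤ q.D) (hT : p.T + 2 * s ≤ q.T)
    (hδ' : p'.δ ≤ q'.δ) (hD' : p'.D + 2 * s ≤ q'.D) (hT' : p'.T + 2 * s ≤ q'.T) :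
    (asymptoticDiagram G A).map f ≫ asymptoticHom G α e he p' q' hδ' hD' hT' ≫ c.ι.app q'
      = asymptoticHom G α e he p q hδ hD hT ≫ c.ι.app q := by
  rw [asymptoticDiagram_map, ← Category.assoc, asymptoticHom_comp]
  exact asymptoticHom_comp_ι G hB c (Category.id_comp α) ((Enlargement.refl L).comp e) e rfl
    _ _ _ _ _ _ _ _ _ _ _

/-- Parameters that a map of spread `s` can reach from the parameters `p`. -/
def targetParam (hB : B.IsLocallyPresented) (s : ℝ≥0) (p : A.Param) : B.Param :=
  (exists_param_add_le hB p s).choose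

theorem targetParam_spec (hB : B.IsLocallyPresented) (s : ℝ≥0) (p : A.Param) :
    p.δ ≤ (targetParam hB s p).δ ∧ p.D + 2 * s ≤ (targetParam hB s p).D ∧
      p.T + 2 * s ≤ (targetParam hB s p).T :=
  (exists_param_add_le hB p s).choose_spec

/-- The map of an asymptotic compactified algebra of `A` to a cocone over those of `B`. -/
def asymptoticLeg (hB : B.IsLocallyPresented) (c : Limits.Cocone (asymptoticDiagram G B))
    (α : A ⟶ B) {s : ℝ≥0} (hs : HasSpread α.toHom s) (p : A.Param) :
    (asymptoticDiagram G A).obj p ⟶ c.pt :=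
  asymptoticHom G α (Enlargement.nbhd L s) hs.mem p (targetParam hB s p)
    (targetParam_spec hB s p).1 (targetParam_spec hB s p).2.1
    (targetParam_spec hB s p).2.2 ≫ c.ι.app (targetParam hB s p)

theorem asymptoticDiagram_map_comp_leg (hB : B.IsLocallyPresented)
    (c : Limits.Cocone (asymptoticDiagram G B)) (α : A ⟶ B) {s : ℝ≥0} (hs : HasSpread α.toHom s)
    {p p' : A.Param} (f : p ⟶ p') :
    (asymptoticDiagram G A).map f ≫ asymptoticLeg G hB c α hs p' = asymptoticLeg G hB c α hs p :=
  asymptoticDiagram_map_comp_ι G hB c α (Enlargement.nbhd L s) hs.mem f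
    (targetParam hB s p) (targetParam hB s p') (targetParam_spec hB s p).1
    (targetParam_spec hB s p).2.1 (targetParam_spec hB s p).2.2 (targetParam_spec hB s p').1
    (targetParam_spec hB s p').2.1 (targetParam_spec hB s p').2.2

/-- The maps induced by `α`, as a cocone over the diagram of the source. -/
def asymptoticCocone (hB : B.IsLocallyPresented) (c : Limits.Cocone (asymptoticDiagram G B))
    (α : A ⟶ B) {s : ℝ≥0} (hs : HasSpread α.toHom s) : Limits.Cocone (asymptoticDiagram G A) where
  pt := c.pt
  ι :=
    { app := asymptoticLeg G hB c α hs
      naturality := fun _ _ f => by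
        rw [asymptoticDiagram_map_comp_leg]
        exact (Category.comp_id _).symm }

/-- The asymptotic compactified algebra `colim_{δ,D,T} Cpt_{D,T}(A, δ)`, with its canonical maps. -/
def asymptoticColimit (A : CovariantQuasiLocalAlgebra.{u, w} G₀) :
    Limits.Cocone (asymptoticDiagram G A) :=
  StarAlgCat.colimitCocone.{0, max u v w} (asymptoticDiagram G A)

/-- The universal property of the asymptotic compactified algebra. -/
def asymptoticColimitIsColimit (A : CovariantQuasiLocalAlgebra.{u, w} G₀) :
    Limits.IsColimit (asymptoticColimit G A) :=
  StarAlgCat.colimitCoconeIsColimit.{0, max u v w} (asymptoticDiagram G A)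

/-- The map of asymptotic compactified algebras induced by `α`. -/
def asymptoticColimitMap (hB : B.IsLocallyPresented) (α : A ⟶ B) :
    (asymptoticColimit G A).pt ⟶ (asymptoticColimit G B).pt :=
  (asymptoticColimitIsColimit G A).desc
    (asymptoticCocone G hB (asymptoticColimit G B) α α.bounded_spread.choose_spec)

/-- The map of colimits was built from one chosen spread and chosen target parameters. This frees it
from those choices: any enlargement that keeps `∅` empty and any large enough parameter of the
target compute it. -/
theorem ι_asymptoticColimitMap (hB : B.IsLocallyPresented) (α : A ⟶ B) {s : ℝ≥0}
    (e : Enlargement L s) (h0 : e.toFun ∅ = ∅)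
    (he : ∀ U, ∀ a ∈ A.net U, α.toHom a ∈ B.net (e.toFun U)) (p : A.Param) (q : B.Param)
    (hδ : p.δ ≤ q.δ) (hD : p.D + 2 * s ≤ q.D) (hT : p.T + 2 * s ≤ q.T) :
    (asymptoticColimit G A).ι.app p ≫ asymptoticColimitMap G hB α
      = asymptoticHom G α e he p q hδ hD hT ≫ (asymptoticColimit G B).ι.app q :=
  ((asymptoticColimitIsColimit G A).fac
    (asymptoticCocone G hB (asymptoticColimit G B) α α.bounded_spread.choose_spec) p).trans
    (asymptoticHom_comp_ι G hB (asymptoticColimit G B) rfl (Enlargement.nbhd L _) e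
      ((Enlargement.nbhd_empty L _).trans h0.symm) _ he p _ q _ _ _ hδ hD hT)

/-- The asymptotic compactified algebra as a functor. -/
def asymptoticCptFunctor :
    (locallyPresented.{u, w} G₀).FullSubcategory ⥤ StarAlgCat.{max u v w} where
  obj A := (asymptoticColimit G A.obj).pt
  map {A B} α := asymptoticColimitMap G B.property α.hom
  map_id A := (asymptoticColimitIsColimit G A.obj).hom_ext fun p => by
    -- The identity is computed with the trivial enlargement and with target parameter `p` itself,
    -- where it is the transition map of `𝟙 p`.
    refine (ι_asymptoticColimitMap G A.property (𝟙 A.obj) (Enlargement.refl L) rfl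
      id_mem_net p p le_rfl (by simp) (by simp)).trans ?_
    refine (congrArg (· ≫ _) ((asymptoticDiagram_map G (𝟙 p)).symm.trans
      ((asymptoticDiagram G A.obj).map_id p))).trans ?_
    exact (Category.id_comp _).trans (Category.comp_id _).symm
  map_comp {A B C} α β := (asymptoticColimitIsColimit G A.obj).hom_ext fun p => by
    obtain ⟨s, hs⟩ := α.hom.bounded_spread
    obtain ⟨t, ht⟩ := β.hom.bounded_spread
    obtain ⟨q, hq₁, hq₂, hq₃⟩ := exists_param_add_le B.property p s
    obtain ⟨r, hr₁, hr₂, hr₃⟩ := exists_param_add_le C.property q t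
    rw [← Category.assoc, ι_asymptoticColimitMap G B.property α.hom (Enlargement.nbhd L s)
      (Enlargement.nbhd_empty L s) hs.mem p q hq₁ hq₂ hq₃, Category.assoc,
      ι_asymptoticColimitMap G C.property β.hom (Enlargement.nbhd L t)
      (Enlargement.nbhd_empty L t) ht.mem q r hr₁ hr₂ hr₃, ← Category.assoc, asymptoticHom_comp]
    -- The enlargement here is `U ↦ (U⁺ˢ)⁺ᵗ`, which need not be a neighbourhood of `U` of a single
    -- radius; only its value on `∅` remains to be checked.
    refine ι_asymptoticColimitMap G C.property (α.hom ≫ β.hom) _ ?_ _ p r _ _ _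
    change nbhd t (nbhd s ∅) = ∅
    rw [nbhd, nbhd, Metric.cthickening_empty, Metric.cthickening_empty]

end CovariantQuasiLocalAlgebra

end

theorem mainTheorem4 {L : Type u} [MetricSpace L] [BoundedGeometry L] {G₀ : Subgroup (L ≃ᵢ L)}
    {Λ : Type v} (G : Λ → Subgroup G₀) (hG : AsymptoticallyFree G) :
    (∀ A : CovariantQuasiLocalAlgebra.{u, w} G₀, A.IsLocallyPresented →
      ∀ c : ℝ≥0, ∃ p : A.Param, c ≤ p.δ ∧ c ≤ p.D ∧ c ≤ p.T) ∧
    (∀ (A : CovariantQuasiLocalAlgebra.{u, w} G₀) (p q : A.Param) (h : p ≤ q), p.T = q.T →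
      Function.Bijective (CovariantQuasiLocalAlgebra.asymptoticTransition G h)) ∧
    ∃ (F : (CovariantQuasiLocalAlgebra.locallyPresented.{u, w} G₀).FullSubcategory ⥤
          StarAlgCat.{max u v w})
      (κ : ∀ A : (CovariantQuasiLocalAlgebra.locallyPresented.{u, w} G₀).FullSubcategory,
        CovariantQuasiLocalAlgebra.asymptoticDiagram G A.obj ⟶
          (Functor.const A.obj.Param).obj (F.obj A)),
      (∀ A, Nonempty (Limits.IsColimit (Limits.Cocone.mk (F.obj A) (κ A)))) ∧
      ∀ {A B : (CovariantQuasiLocalAlgebra.locallyPresented.{u, w} G₀).FullSubcategory}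
        (α : A ⟶ B) (s : ℝ≥0) (hs : CovariantQuasiLocalAlgebra.HasSpread α.hom.toHom s)
        (p : A.obj.Param) (q : B.obj.Param)
        (hδ : p.δ ≤ q.δ) (hD : p.D + 2 * s ≤ q.D) (hT : p.T + 2 * s ≤ q.T),
        (κ A).app p ≫ F.map α
          = StarAlgCat.ofHom (CovariantQuasiLocalAlgebra.asymptoticMap G α.hom hs p q hδ hD hT)
            ≫ (κ B).app q := by
  refine ⟨fun A hA c => hA.exists_param_ge c, fun A p q h hT =>
    CovariantQuasiLocalAlgebra.asymptoticTransition_bijective hG h hT,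
    CovariantQuasiLocalAlgebra.asymptoticCptFunctor G,
    fun A => (CovariantQuasiLocalAlgebra.asymptoticColimit G A.obj).ι,
    fun A => ⟨CovariantQuasiLocalAlgebra.asymptoticColimitIsColimit G A.obj⟩, ?_⟩
  intro A B α s hs p q hδ hD hT
  exact CovariantQuasiLocalAlgebra.ι_asymptoticColimitMap G B.property α.hom
    (Enlargement.nbhd L s) (Enlargement.nbhd_empty L s) hs.mem p q hδ hD hT
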